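/- Let $\varphi:[0,\infty)\to[0,\infty)$ be an Orlicz function, i.e. $\varphi$ is convex, $\varphi(0)=0$ and $\varphi(t)>0$ for $t>0$, and let $\varphi_*(v)=\sup_{u\ge 0}(uv-\varphi(u))\in[0,\infty]$ be its complementary function. **Function case.** Let $0<\gamma\le\infty$, $I=[0,\gamma)$ with Lebesgue measure $m$, let $L^0$ be the space of (classes of a.e. equal) real measurable functions on $I$, and let $w$ be a positive, decreasing (not necessarily strictly) and locally integrable weight on $I$ (allowed to be unbounded at $0$), with $\int_0^\infty w=\infty$ if $\gamma=\infty$. For $f\in L^0$ let $f^*(t)=\inf\{\lambda>0: m\{|f|>\lambda\}\le t\}$ be its decreasing rearrangement and $\rho_{\varphi,w}(f)=\int_I\varphi(f^*)w$, with $\rho_{\varphi_*,w}$ defined in the same way. The Orlicz–Lorentz space $\Lambda_{\varphi,w}$ consists of all $f\in L^0$ with $\rho_{\varphi,w}(\lambda f)<\infty$ for some $\lambda>0$. It carries the Luxemburg norm $\|f\|=\inf\{\varepsilon>0:\rho_{\varphi,w}(f/\varepsilon)\le 1\}$ and the Orlicz norm $\|f\|^0=\sup\{\int_I f^*g^*w:\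 g\in L^0,\ \rho_{\varphi_*,w}(g)\le 1\}$; write $\Lambda_{\varphi,w}$ and $\Lambda^0_{\varphi,w}$ for the two normed spaces. For such a normed space $X$, let $X_a$ be the set of order-continuous elements: those $f\in X$ such that the norm of $x_n$ tends to $0$ whenever $0\le x_n\le|f|$ and $x_n\downarrow0$ a.e. A singular functional on $X$ is a bounded linear functional $S:X\to\mathbb R$ with $S(f)=0$ for all $f\in X_a$. Put $\theta(f)=\inf\{\lambda>0:\rho_{\varphi,w}(f/\lambda)<\infty\}$. Let $S$ be a singular functional on $\Lambda_{\varphi,w}$ or on $\Lambda_{\varphi,w}^0$. Then $S$ is bounded for both norms, and $$\|S\|_{(\Lambda_{\varphi,w})^*}=\|S\|_{(\Lambda_{\varphi,w}^0)^*}=\sup\{S(f):\rho_{\varphi,w}(f)<\infty\}=\sup\Big\{\frac{S(f)}{\theta(f)}: f\in\Lambda_{\varphi,w}\setminus(\Lambda_{\varphi,w})_a\Big\},$$ where the last supremum is read as $0$ if $\Lambda_{\varphi,w}=(\Lambda_{\varphi,w})_a$. **Sequence case.** Let $w=(w(i))_{i\ge1}$ be a positive decreasing (not necessarily strictly) sequence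 with $\sum_i w(i)=\infty$. For a real sequence $x$ let $x^*(i)=\inf\{\lambda>0:|\{j:|x(j)|>\lambda\}|<i\}$ and $\alpha_{\varphi,w}(x)=\sum_{i\ge1}\varphi(x^*(i))w(i)$, and define the space $\lambda_{\varphi,w}$, its Luxemburg norm, its Orlicz norm (with $\sum_i x^*(i)y^*(i)w(i)$ in place of the integral), order-continuous elements, singular functionals and $\theta$ as above, with $\alpha$ in place of $\rho$. Then, for every singular functional $S$ on $\lambda_{\varphi,w}$ or on $\lambda^0_{\varphi,w}$, $S$ is bounded for both norms, and $$\|S\|_{(\lambda_{\varphi,w})^*}=\|S\|_{(\lambda_{\varphi,w}^0)^*}=\sup\{S(x):\alpha_{\varphi,w}(x)<\infty\}=\sup\Big\{\frac{S(x)}{\theta(x)}: x\in\lambda_{\varphi,w}\setminus(\lambda_{\varphi,w})_a\Big\},$$ with the last supremum read as $0$ if $\lambda_{\varphi,w}=(\lambda_{\varphi,w})_a$. -/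

import Mathlib

open MeasureTheory Filter Topology Set
open scoped ENNReal NNReal

namespace OrliczLorentz

noncomputable section

/-! ### Orlicz functions -/

/-- An Orlicz function `φ : [0, ∞) → [0, ∞)`: convex, `φ 0 = 0` and `φ t > 0` for `t > 0`.
(The values of `toFun` at negative reals are irrelevant.) -/
structure OrliczFunction where
  toFun : ℝ → ℝ
  convexOn : ConvexOn ℝ (Ici 0) toFun
  map_zero : toFun 0 = 0
  pos : ∀ t, 0 < t → 0 < toFun t

/-- `φ` as a function `[0, ∞] → [0, ∞]`, with `φ(∞) = ∞`. -/
def OrliczFunction.ext (φ : OrliczFunction) (u : ℝ≥0∞) : ℝ≥0∞ :=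
  if u = ⊤ then ⊤ else ENNReal.ofReal (φ.toFun u.toReal)

/-- The complementary function `φ_*(v) = sup_{u ≥ 0} (u v - φ(u))`, with values in `[0, ∞]`.
The subtraction of `ℝ≥0∞` is truncated at `0`, which is harmless because `u = 0` contributes `0`
to the supremum. -/
def OrliczFunction.compl (φ : OrliczFunction) (v : ℝ≥0∞) : ℝ≥0∞ :=
  ⨆ u : ℝ≥0, ((u : ℝ≥0∞) * v - ENNReal.ofReal (φ.toFun u))

theorem OrliczFunction.ext_mono (φ : OrliczFunction) : Monotone φ.ext := by
  have hnn : ∀ t, 0 ≤ t → 0 ≤ φ.toFun t := by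
    intro t ht
    rcases ht.eq_or_lt with h | h
    · rw [← h, φ.map_zero]
    · exact (φ.pos t h).le
  intro a b hab
  unfold OrliczFunction.ext
  by_cases hb : b = ⊤
  · simp [hb]
  have ha : a ≠ ⊤ := ne_top_of_le_ne_top hb hab
  rw [if_neg ha, if_neg hb]
  apply ENNReal.ofReal_le_ofReal
  have h1 : a.toReal ≤ b.toReal := ENNReal.toReal_mono hb hab
  have h0 : 0 ≤ a.toReal := ENNReal.toReal_nonneg
  rcases h0.eq_or_lt with h | h
  · rw [← h, φ.map_zero]
    exact hnn _ ENNReal.toReal_nonneg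
  · have hbp : 0 < b.toReal := h.trans_le h1
    have hr : a.toReal / b.toReal ≤ 1 := (div_le_one hbp).2 h1
    have hr0 : 0 ≤ a.toReal / b.toReal := div_nonneg h0 hbp.le
    have key := φ.convexOn.2 (x := b.toReal) (y := 0) (mem_Ici.2 hbp.le) (mem_Ici.2 le_rfl)
      hr0 (sub_nonneg.2 hr) (by ring)
    simp only [smul_eq_mul, mul_zero, add_zero, φ.map_zero] at key
    rw [div_mul_cancel₀ _ hbp.ne'] at key
    exact key.trans (mul_le_of_le_one_left (hnn _ hbp.le) hr)

/-! ### Decreasing rearrangements, modulars and norms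

`α →ₘ[μ] ℝ` is the space `L⁰` of real measurable functions modulo equality almost everywhere. -/

section General

variable {α : Type*} [MeasurableSpace α] {μ : Measure α}

/-- The distribution function `d_f(c) = μ {|f| > c}`. -/
def distribution (f : α →ₘ[μ] ℝ) (c : ℝ≥0∞) : ℝ≥0∞ := μ {a | c < ‖f a‖ₑ}

/-- The decreasing rearrangement `f^*(t) = inf {c : d_f(c) ≤ t}`, with values in `[0, ∞]`. -/
def rearr (f : α →ₘ[μ] ℝ) (t : ℝ≥0∞) : ℝ≥0∞ := sInf {c | distribution f c ≤ t}

/-! In the following, `J` stands for integration (or summation) against the weight,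
`J h = ∫ h(t) w(t) dt` or `J h = ∑ h(i) w(i)`; see `functionIntegral` and `sequenceSum` below. -/

/-- The modular `ρ(f) = J (Φ ∘ f^*)`; the function `Φ` is an Orlicz function or a
complementary function. -/
def modular (J : (ℝ≥0∞ → ℝ≥0∞) → ℝ≥0∞) (Φ : ℝ≥0∞ → ℝ≥0∞) (f : α →ₘ[μ] ℝ) : ℝ≥0∞ :=
  J fun t => Φ (rearr f t)

/-- The Luxemburg norm `‖f‖ = inf {ε > 0 : ρ_φ(f / ε) ≤ 1}`. -/
def luxemburgNorm (J : (ℝ≥0∞ → ℝ≥0∞) → ℝ≥0∞) (φ : OrliczFunction) (f : α →ₘ[μ] ℝ) : ℝ≥0∞ :=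
  ⨅ (ε : ℝ) (_ : 0 < ε ∧ modular J φ.ext (ε⁻¹ • f) ≤ 1), ENNReal.ofReal ε

/-- The Orlicz norm `‖f‖⁰ = sup {J (f^* g^*) : ρ_{φ_*}(g) ≤ 1}`. -/
def orliczNorm (J : (ℝ≥0∞ → ℝ≥0∞) → ℝ≥0∞) (φ : OrliczFunction) (f : α →ₘ[μ] ℝ) : ℝ≥0∞ :=
  ⨆ (g : α →ₘ[μ] ℝ) (_ : modular J φ.compl g ≤ 1), J fun t => rearr f t * rearr g t

/-- `θ(f) = inf {c > 0 : ρ_φ(f / c) < ∞}`. For `f` in the Orlicz-Lorentz space the set is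
nonempty. -/
def theta (J : (ℝ≥0∞ → ℝ≥0∞) → ℝ≥0∞) (φ : OrliczFunction) (f : α →ₘ[μ] ℝ) : ℝ :=
  sInf {c : ℝ | 0 < c ∧ modular J φ.ext (c⁻¹ • f) < ⊤}

/-- `f` is order-continuous for the norm `N`: if `0 ≤ x_n ≤ |f|` and `x_n ↓ 0` almost everywhere,
then `N (x_n) → 0`. -/
def IsOrderContinuous (N : (α →ₘ[μ] ℝ) → ℝ≥0∞) (f : α →ₘ[μ] ℝ) : Prop :=
  ∀ x : ℕ → (α →ₘ[μ] ℝ), (∀ n, 0 ≤ x n ∧ x n ≤ |f|) → Antitone x →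
    (∀ᵐ a ∂μ, Tendsto (fun n => x n a) atTop (𝓝 0)) →
    Tendsto (fun n => N (x n)) atTop (𝓝 0)

/-- The linear functional `S` on `X` is bounded when `X` carries the norm `N`. -/
def IsBoundedFunctional (N : (α →ₘ[μ] ℝ) → ℝ≥0∞) {X : Submodule ℝ (α →ₘ[μ] ℝ)}
    (S : X →ₗ[ℝ] ℝ) : Prop :=
  ∃ C : ℝ≥0, ∀ f : X, ‖S f‖ₑ ≤ C * N f

/-- `S` is a singular functional on `X` with the norm `N`: it is bounded and vanishes at all
order-continuous elements of `X`. -/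
def IsSingular (N : (α →ₘ[μ] ℝ) → ℝ≥0∞) {X : Submodule ℝ (α →ₘ[μ] ℝ)} (S : X →ₗ[ℝ] ℝ) : Prop :=
  IsBoundedFunctional N S ∧ ∀ f : X, IsOrderContinuous N (f : α →ₘ[μ] ℝ) → S f = 0

/-- The norm of a bounded functional `S` on `X` with the norm `N`. -/
def dualNorm (N : (α →ₘ[μ] ℝ) → ℝ≥0∞) {X : Submodule ℝ (α →ₘ[μ] ℝ)} (S : X →ₗ[ℝ] ℝ) : ℝ :=
  sSup {r | ∃ f : X, N f ≤ 1 ∧ r = |S f|}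

/-! Facts needed to see that the Orlicz-Lorentz spaces are linear. -/

theorem rearr_antitone (f : α →ₘ[μ] ℝ) : Antitone (rearr f) := fun _ _ hst =>
  sInf_le_sInf fun _ hc => le_trans hc hst

theorem rearr_le_max {f g h : α →ₘ[μ] ℝ} (H : ∀ᵐ a ∂μ, ‖h a‖ₑ ≤ max ‖f a‖ₑ ‖g a‖ₑ) (t : ℝ≥0∞) :
    rearr h t ≤ max (rearr f (t / 2)) (rearr g (t / 2)) := by
  refine le_of_forall_gt fun c hc => ?_
  have hdist : ∀ k : α →ₘ[μ] ℝ, ∀ b b' : ℝ≥0∞, b ≤ b' → distribution k b' ≤ distribution k b :=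
    fun k b b' hb => measure_mono fun a ha => lt_of_le_of_lt hb ha
  obtain ⟨h1, h2⟩ := max_lt_iff.1 hc
  obtain ⟨b1, hb1, hb1c⟩ := sInf_lt_iff.1 h1
  obtain ⟨b2, hb2, hb2c⟩ := sInf_lt_iff.1 h2
  refine lt_of_le_of_lt (sInf_le ?_) (max_lt hb1c hb2c)
  change distribution h (max b1 b2) ≤ t
  calc distribution h (max b1 b2)
      ≤ μ ({a | max b1 b2 < ‖f a‖ₑ} ∪ {a | max b1 b2 < ‖g a‖ₑ}) := by
        refine measure_mono_ae ?_
        filter_upwards [H] with a ha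
        intro (hlt : max b1 b2 < ‖h a‖ₑ)
        exact lt_max_iff.1 (hlt.trans_le ha)
    _ ≤ distribution f (max b1 b2) + distribution g (max b1 b2) := measure_union_le _ _
    _ ≤ t / 2 + t / 2 := add_le_add ((hdist f _ _ (le_max_left _ _)).trans hb1)
        ((hdist g _ _ (le_max_right _ _)).trans hb2)
    _ = t := ENNReal.add_halves t

/-- The set of all `f` in `L⁰` with `ρ_φ(c f) < ∞` for some `c > 0`. -/
def spaceCarrier (μ : Measure α) (J : (ℝ≥0∞ → ℝ≥0∞) → ℝ≥0∞) (φ : OrliczFunction) :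
    Set (α →ₘ[μ] ℝ) :=
  {f | ∃ c : ℝ, 0 < c ∧ modular J φ.ext (c • f) < ⊤}

/-- The properties of `J` from which linearity of the space follows. -/
structure IsAdmissible (J : (ℝ≥0∞ → ℝ≥0∞) → ℝ≥0∞) : Prop where
  map_zero : J (fun _ => 0) = 0
  mono : ∀ h k : ℝ≥0∞ → ℝ≥0∞, (∀ t, h t ≤ k t) → J h ≤ J k
  add_le : ∀ h k : ℝ≥0∞ → ℝ≥0∞, Antitone h → Antitone k → J (fun t => h t + k t) ≤ J h + J k
  half_le : ∀ h : ℝ≥0∞ → ℝ≥0∞, Antitone h → J (fun t => h (t / 2)) ≤ 2 * J h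

theorem modular_le {J : (ℝ≥0∞ → ℝ≥0∞) → ℝ≥0∞} (hJ : IsAdmissible J) (φ : OrliczFunction)
    {f g h : α →ₘ[μ] ℝ} (H : ∀ᵐ a ∂μ, ‖h a‖ₑ ≤ max ‖f a‖ₑ ‖g a‖ₑ) :
    modular J φ.ext h ≤ 2 * modular J φ.ext f + 2 * modular J φ.ext g := by
  have han : ∀ k : α →ₘ[μ] ℝ, Antitone fun t => φ.ext (rearr k t) := fun k =>
    φ.ext_mono.comp_antitone (rearr_antitone k)
  have hhalf : Monotone fun t : ℝ≥0∞ => t / 2 := fun s t hst => ENNReal.div_le_div_right hst 2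
  calc modular J φ.ext h
      ≤ J (fun t => φ.ext (rearr f (t / 2)) + φ.ext (rearr g (t / 2))) := by
        refine hJ.mono _ _ fun t => ?_
        refine (φ.ext_mono (rearr_le_max H t)).trans ?_
        rw [φ.ext_mono.map_max]
        exact max_le le_self_add le_add_self
    _ ≤ _ := hJ.add_le _ _ ((han f).comp_monotone hhalf) ((han g).comp_monotone hhalf)
    _ ≤ _ := add_le_add (hJ.half_le _ (han f)) (hJ.half_le _ (han g))

/-- The Orlicz-Lorentz space as a linear subspace of `L⁰`. -/
def space (μ : Measure α) {J : (ℝ≥0∞ → ℝ≥0∞) → ℝ≥0∞} (hJ : IsAdmissible J)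
    (φ : OrliczFunction) : Submodule ℝ (α →ₘ[μ] ℝ) where
  carrier := spaceCarrier μ J φ
  zero_mem' := by
    refine ⟨1, one_pos, ?_⟩
    have hr : ∀ t, rearr ((1 : ℝ) • (0 : α →ₘ[μ] ℝ)) t = 0 := by
      intro t
      refine le_antisymm (sInf_le ?_) bot_le
      have : distribution ((1 : ℝ) • (0 : α →ₘ[μ] ℝ)) 0 = 0 := by
        have h0 : ∀ᵐ a ∂μ, ¬ (0 < ‖(0 : α →ₘ[μ] ℝ) a‖ₑ) := by
          filter_upwards [AEEqFun.coeFn_zero (α := α) (μ := μ) (β := ℝ)] with a ha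
          simp [ha]
        rw [smul_zero, distribution]
        simpa only [not_not] using ae_iff.1 h0
      change distribution _ 0 ≤ t
      rw [this]
      exact bot_le
    have : modular J φ.ext ((1 : ℝ) • (0 : α →ₘ[μ] ℝ)) = 0 := by
      unfold modular
      simp only [hr]
      simp [OrliczFunction.ext, φ.map_zero, hJ.map_zero]
    rw [this]
    exact ENNReal.zero_lt_top
  add_mem' := by
    rintro f g ⟨c, hc, hf⟩ ⟨d, hd, hg⟩
    refine ⟨min c d / 2, by positivity, ?_⟩
    refine (modular_le hJ φ (f := c • f) (g := d • g) ?_).trans_lt ?_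
    · filter_upwards [AEEqFun.coeFn_smul (min c d / 2) (f + g), AEEqFun.coeFn_add f g,
        AEEqFun.coeFn_smul c f, AEEqFun.coeFn_smul d g] with a h1 h2 h3 h4
      have hm : 0 < min c d := lt_min hc hd
      rw [h1, h3, h4, Pi.smul_apply, h2, Pi.add_apply, Pi.smul_apply, Pi.smul_apply]
      simp only [smul_eq_mul, Real.enorm_eq_ofReal_abs, abs_mul]
      rw [← ENNReal.ofReal_max]
      apply ENNReal.ofReal_le_ofReal
      rw [abs_of_pos hc, abs_of_pos hd, abs_of_pos (by positivity : 0 < min c d / 2)]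
      have h5 : min c d * |f a| ≤ c * |f a| :=
        mul_le_mul_of_nonneg_right (min_le_left _ _) (abs_nonneg _)
      have h6 : min c d * |g a| ≤ d * |g a| :=
        mul_le_mul_of_nonneg_right (min_le_right _ _) (abs_nonneg _)
      have h7 := mul_le_mul_of_nonneg_left (abs_add_le (f a) (g a)) hm.le
      have h8 := le_max_left (c * |f a|) (d * |g a|)
      have h9 := le_max_right (c * |f a|) (d * |g a|)
      linarith
    · exact ENNReal.add_lt_top.2
        ⟨ENNReal.mul_lt_top (by simp) hf, ENNReal.mul_lt_top (by simp) hg⟩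
  smul_mem' := by
    rintro b f ⟨c, hc, hf⟩
    refine ⟨c / (|b| + 1), by positivity, ?_⟩
    refine (modular_le hJ φ (f := c • f) (g := c • f) ?_).trans_lt ?_
    · filter_upwards [AEEqFun.coeFn_smul (c / (|b| + 1)) (b • f), AEEqFun.coeFn_smul b f,
        AEEqFun.coeFn_smul c f] with a h1 h2 h3
      rw [max_self, h1, h3, Pi.smul_apply, h2, Pi.smul_apply, Pi.smul_apply]
      simp only [smul_eq_mul, Real.enorm_eq_ofReal_abs, abs_mul]
      apply ENNReal.ofReal_le_ofReal
      have hb : 0 < |b| + 1 := by positivity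
      rw [abs_of_pos hc, abs_of_pos (div_pos hc hb), ← mul_assoc]
      refine mul_le_mul_of_nonneg_right ?_ (abs_nonneg _)
      rw [div_mul_eq_mul_div, div_le_iff₀ hb]
      nlinarith
    · exact ENNReal.add_lt_top.2
        ⟨ENNReal.mul_lt_top (by simp) hf, ENNReal.mul_lt_top (by simp) hf⟩

end General

/-! ### The function spaces `Λ_{φ,w}` -/

/-- The interval `I = [0, γ)`, `0 < γ ≤ ∞`. -/
def interval (γ : ℝ≥0∞) : Set ℝ := {t | 0 ≤ t ∧ ENNReal.ofReal t < γ}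

/-- Lebesgue measure on `I = [0, γ)`. -/
def intervalMeasure (γ : ℝ≥0∞) : Measure ℝ := volume.restrict (interval γ)

/-- A weight on `I = [0, γ)`: positive, decreasing (in the wide sense), integrable near `0` and
hence locally integrable, and with `∫_0^∞ w = ∞` if `γ = ∞`. The value at the single point `0`
plays no role, so that weights unbounded near `0` are included. -/
structure FunctionWeight (γ : ℝ≥0∞) where
  toFun : ℝ → ℝ
  pos : ∀ t ∈ interval γ, 0 < t → 0 < toFun t
  antitone : AntitoneOn toFun (interval γ ∩ Ioi 0)
  integrable : ∀ t ∈ interval γ, IntegrableOn toFun (Ioo 0 t)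
  infinite : γ = ⊤ → ∫⁻ t in Ioi 0, ENNReal.ofReal (toFun t) = ⊤

/-- `J h = ∫_0^γ h(t) w(t) dt`. -/
def functionIntegral {γ : ℝ≥0∞} (w : FunctionWeight γ) (h : ℝ≥0∞ → ℝ≥0∞) : ℝ≥0∞ :=
  ∫⁻ t, h (ENNReal.ofReal t) * ENNReal.ofReal (w.toFun t) ∂(intervalMeasure γ)

theorem isAdmissible_functionIntegral {γ : ℝ≥0∞} (w : FunctionWeight γ) :
    IsAdmissible (functionIntegral w) where
  map_zero := by simp [functionIntegral]
  mono h k hk := lintegral_mono fun t => by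
    have := hk (ENNReal.ofReal t)
    dsimp only
    gcongr
  add_le h k hh _ := by
    unfold functionIntegral
    have hI : MeasurableSet (interval γ ∩ Ioi 0) := by
      unfold interval
      exact ((measurableSet_Ici (a := (0 : ℝ))).inter
        (measurableSet_lt ENNReal.measurable_ofReal measurable_const)).inter measurableSet_Ioi
    have hw : AEMeasurable w.toFun (intervalMeasure γ) := by
      have h1 : AEMeasurable w.toFun (volume.restrict (interval γ ∩ Ioi 0)) :=
        aemeasurable_restrict_of_antitoneOn hI w.antitone
      have h2 : (interval γ ∩ Ioi 0 : Set ℝ) =ᵐ[volume] interval γ := by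
        have h3 : ∀ᵐ t : ℝ, t ≠ 0 := by simp [ae_iff]
        filter_upwards [h3] with t ht
        apply propext
        change (t ∈ interval γ ∧ 0 < t) ↔ t ∈ interval γ
        exact ⟨fun h => h.1, fun h => ⟨h, lt_of_le_of_ne h.1 (Ne.symm ht)⟩⟩
      rwa [Measure.restrict_congr_set h2] at h1
    simp only [add_mul]
    refine (lintegral_add_left' ?_ _).le
    exact (hh.measurable.comp ENNReal.measurable_ofReal).aemeasurable.mul hw.ennreal_ofReal
  half_le h _ := by
    unfold functionIntegral intervalMeasure
    have hI : MeasurableSet (interval γ) := by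
      unfold interval
      exact (measurableSet_Ici (a := (0 : ℝ))).inter
        (measurableSet_lt ENNReal.measurable_ofReal measurable_const)
    rw [← lintegral_indicator hI, ← lintegral_indicator hI]
    have hmap : (volume : Measure ℝ) = (2 : ℝ≥0∞) • Measure.map (fun x : ℝ => 2 * x) volume := by
      rw [Real.map_volume_mul_left (by norm_num), smul_smul]
      rw [abs_of_pos (by norm_num), ← ENNReal.ofReal_ofNat, ← ENNReal.ofReal_mul (by norm_num)]
      norm_num
    conv_lhs => rw [hmap]
    have hemb : MeasurableEmbedding fun x : ℝ => 2 * x :=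
      (Homeomorph.mulLeft₀ (2 : ℝ) two_ne_zero).measurableEmbedding
    rw [lintegral_smul_measure, smul_eq_mul, hemb.lintegral_map]
    gcongr 2 * ?_
    refine lintegral_mono_ae ?_
    have h3 : ∀ᵐ t : ℝ, t ≠ 0 := by simp [ae_iff]
    filter_upwards [h3] with s hs
    by_cases hm : 2 * s ∈ interval γ
    · have hs0 : 0 < s := lt_of_le_of_ne (by have := hm.1; linarith) (Ne.symm hs)
      have hs' : s ∈ interval γ :=
        ⟨hs0.le, lt_of_le_of_lt (ENNReal.ofReal_le_ofReal (by linarith)) hm.2⟩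
      rw [indicator_of_mem hm, indicator_of_mem hs']
      have e : ENNReal.ofReal (2 * s) / 2 = ENNReal.ofReal s := by
        rw [← ENNReal.ofReal_ofNat 2, ← ENNReal.ofReal_div_of_pos (by norm_num)]
        congr 1
        ring
      rw [e]
      gcongr
      exact w.antitone ⟨hs', hs0⟩ ⟨hm, by simpa using hs0⟩ (by linarith)
    · rw [indicator_of_notMem hm]
      exact bot_le

/-- The Orlicz-Lorentz function space `Λ_{φ,w}` over `[0, γ)`. -/
def functionSpace (φ : OrliczFunction) {γ : ℝ≥0∞} (w : FunctionWeight γ) :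
    Submodule ℝ (ℝ →ₘ[intervalMeasure γ] ℝ) :=
  space (intervalMeasure γ) (isAdmissible_functionIntegral w) φ

/-! ### The sequence spaces `λ_{φ,w}`, inside `ℓ⁰ = L⁰(ℕ)` for the counting measure -/

/-- A weight on `ℕ`: a positive decreasing (in the wide sense) sequence with infinite sum. -/
structure SequenceWeight where
  toFun : ℕ → ℝ
  pos : ∀ i, 0 < toFun i
  antitone : Antitone toFun
  not_summable : ¬ Summable toFun

/-- `J h = ∑_i h(i) w(i)`. The index starts at `0`, so that the usual `x^*(i + 1)` is
`inf {c : d_x(c) < i + 1} = inf {c : d_x(c) ≤ i} = rearr x i`. -/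
def sequenceSum (w : SequenceWeight) (h : ℝ≥0∞ → ℝ≥0∞) : ℝ≥0∞ :=
  ∑' i : ℕ, h i * ENNReal.ofReal (w.toFun i)

theorem isAdmissible_sequenceSum (w : SequenceWeight) : IsAdmissible (sequenceSum w) where
  map_zero := by simp [sequenceSum]
  mono h k hk := ENNReal.tsum_le_tsum fun i => by
    have := hk i
    gcongr
  add_le h k _ _ := by
    unfold sequenceSum
    simp only [add_mul]
    exact ENNReal.tsum_add.le
  half_le h hh := by
    unfold sequenceSum
    rw [← tsum_even_add_odd ENNReal.summable ENNReal.summable, two_mul]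
    refine add_le_add (ENNReal.tsum_le_tsum fun k => ?_) (ENNReal.tsum_le_tsum fun k => ?_)
    · refine mul_le_mul' (hh ?_) (ENNReal.ofReal_le_ofReal (w.antitone (by omega)))
      rw [ENNReal.le_div_iff_mul_le (by simp) (by simp)]
      push_cast
      rw [mul_comm]
    · refine mul_le_mul' (hh ?_) (ENNReal.ofReal_le_ofReal (w.antitone (by omega)))
      rw [ENNReal.le_div_iff_mul_le (by simp) (by simp)]
      push_cast
      rw [mul_comm]
      exact le_self_add

/-- The Orlicz-Lorentz sequence space `λ_{φ,w}`. -/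
def sequenceSpace (φ : OrliczFunction) (w : SequenceWeight) :
    Submodule ℝ (ℕ →ₘ[Measure.count] ℝ) :=
  space Measure.count (isAdmissible_sequenceSum w) φ

end

end OrliczLorentz

open OrliczLorentz

namespace OrliczLorentz

/-! ### Orlicz functions and their subgradients -/

namespace OrliczFunction

/-! A singular functional does not see the order-continuous part of a function, and a function of
finite modular is order-continuous up to a remainder of arbitrarily small modular. If `ρ(f) < ∞`,
dominated convergence gives `ρ(f - fₙ) → 0` for the truncations `fₙ`, on which `S` vanishes. Young's
inequality bounds the Orlicz norm by `1 + ρ`, so `S f = S (f - fₙ)` is at most `(1 + ε)` times the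
norm of `S` dual to the Orlicz norm (`le_dualNorm_orliczNorm`).

Conversely, an element of the Luxemburg unit ball has finite modular after division by a number
close to `1`, so the norm dual to the Luxemburg norm is at most the supremum of `S` over finite
modulars (`dualNorm_luxemburgNorm_le`). The Luxemburg norm is the smaller norm, so its dual norm is
the larger one; this closes the circle of inequalities. The formula with `θ` follows by scaling: `f
/ c` has finite modular for every `c > θ(f)`, and finite modular forces `θ(f) ≤ 1`.

The main analytic input is `luxemburgNorm_le_orliczNorm`: for truncations, test against `p(|f|)`,
with `p` the right derivative of `φ`, where Young's inequality is an equality; then pass to the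
limit by Fatou. Functions and sequences are treated together through `IsWeightMeasure`. -/

theorem nonneg (φ : OrliczFunction) {t : ℝ} (ht : 0 ≤ t) : 0 ≤ φ.toFun t := by
  rcases ht.eq_or_lt with h | h
  · rw [← h, φ.map_zero]
  · exact (φ.pos t h).le

theorem ext_ofReal (φ : OrliczFunction) {t : ℝ} (ht : 0 ≤ t) :
    φ.ext (ENNReal.ofReal t) = ENNReal.ofReal (φ.toFun t) := by
  rw [OrliczFunction.ext, if_neg ENNReal.ofReal_ne_top, ENNReal.toReal_ofReal ht]

theorem ext_zero (φ : OrliczFunction) : φ.ext 0 = 0 := by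
  simp [OrliczFunction.ext, φ.map_zero]

theorem ext_lt_top (φ : OrliczFunction) {u : ℝ≥0∞} (hu : u < ⊤) : φ.ext u < ⊤ := by
  simp [OrliczFunction.ext, hu.ne]

theorem ext_pos (φ : OrliczFunction) {u : ℝ≥0∞} (hu : 0 < u) : 0 < φ.ext u := by
  unfold OrliczFunction.ext
  split_ifs with h
  · exact ENNReal.zero_lt_top
  · exact ENNReal.ofReal_pos.2 (φ.pos _ (ENNReal.toReal_pos hu.ne' h))

theorem mono (φ : OrliczFunction) {s t : ℝ} (hs : 0 ≤ s) (hst : s ≤ t) :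
    φ.toFun s ≤ φ.toFun t := by
  have := φ.ext_mono (ENNReal.ofReal_le_ofReal hst)
  rw [φ.ext_ofReal hs, φ.ext_ofReal (hs.trans hst)] at this
  exact (ENNReal.ofReal_le_ofReal_iff (φ.nonneg (hs.trans hst))).1 this

theorem toFun_mul_le (φ : OrliczFunction) {r t : ℝ} (hr : 0 ≤ r) (hr1 : r ≤ 1) (ht : 0 ≤ t) :
    φ.toFun (r * t) ≤ r * φ.toFun t := by
  have := φ.convexOn.2 (x := t) (y := 0) (mem_Ici.2 ht) (mem_Ici.2 le_rfl)
    hr (sub_nonneg.2 hr1) (by ring)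
  simpa [φ.map_zero] using this

/-- Convexity and `φ(0) = 0` give `φ(u) ≤ u φ(1)` on `[0, 1]`. This settles the boundary point `0`,
where convexity alone does not give continuity. -/
theorem tendsto_ext_zero (φ : OrliczFunction) : Tendsto φ.ext (𝓝 0) (𝓝 0) := by
  have h1 : Tendsto (fun u : ℝ≥0∞ => u * ENNReal.ofReal (φ.toFun 1)) (𝓝 0) (𝓝 0) := by
    simpa using ENNReal.Tendsto.mul_const (b := ENNReal.ofReal (φ.toFun 1))
      (tendsto_id (x := 𝓝 (0 : ℝ≥0∞))) (Or.inr ENNReal.ofReal_ne_top)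
  refine tendsto_of_tendsto_of_tendsto_of_le_of_le' tendsto_const_nhds h1
    (Eventually.of_forall fun _ => bot_le) ?_
  filter_upwards [Iic_mem_nhds (zero_lt_one (α := ℝ≥0∞))] with u (hu : u ≤ 1)
  have hut : u ≠ ⊤ := ne_top_of_le_ne_top ENNReal.one_ne_top hu
  have hu1 : u.toReal ≤ 1 := by simpa using ENNReal.toReal_mono ENNReal.one_ne_top hu
  conv_rhs => rw [← ENNReal.ofReal_toReal hut]
  rw [OrliczFunction.ext, if_neg hut, ← ENNReal.ofReal_mul ENNReal.toReal_nonneg]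
  apply ENNReal.ofReal_le_ofReal
  simpa using φ.toFun_mul_le ENNReal.toReal_nonneg hu1 zero_le_one

theorem compl_mono (φ : OrliczFunction) : Monotone φ.compl := fun a b hab =>
  iSup_mono fun u => tsub_le_tsub_right (by gcongr) _

/-- Young's inequality. -/
theorem mul_le_ext_add_compl (φ : OrliczFunction) (u v : ℝ≥0∞) :
    u * v ≤ φ.ext u + φ.compl v := by
  rcases eq_or_ne u ⊤ with rfl | hu
  · simp [OrliczFunction.ext]
  · rw [OrliczFunction.ext, if_neg hu]
    refine le_add_tsub.trans (add_le_add le_rfl ?_)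
    have := le_iSup (fun x : ℝ≥0 => (x : ℝ≥0∞) * v - ENNReal.ofReal (φ.toFun x)) u.toNNReal
    rw [ENNReal.coe_toNNReal hu] at this
    exact this

/-- Since `R⁻¹ ≤ 1`, each term satisfies `u (R⁻¹ v) - φ(u) ≤ R⁻¹ (u v - φ(u))`. It serves to
normalise a test function whose complementary modular exceeds `1`. -/
theorem compl_inv_mul_le (φ : OrliczFunction) {R : ℝ≥0∞} (hR : 1 ≤ R) (v : ℝ≥0∞) :
    φ.compl (R⁻¹ * v) ≤ R⁻¹ * φ.compl v := by
  refine iSup_le fun u => ?_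
  have hR1 : R⁻¹ ≤ 1 := ENNReal.inv_le_one.2 hR
  refine le_trans ?_ (mul_le_mul' le_rfl (le_iSup _ u))
  rw [ENNReal.mul_sub (fun _ _ => ne_top_of_le_ne_top ENNReal.one_ne_top hR1)]
  refine tsub_le_tsub (by rw [mul_left_comm]) (mul_le_of_le_one_left' hR1)

/-- The right derivative of an Orlicz function, as an infimum of difference quotients. -/
noncomputable def rightSlope (φ : OrliczFunction) (u : ℝ) : ℝ :=
  ⨅ v : Ioi u, (φ.toFun v - φ.toFun u) / (v - u)

theorem rightSlope_le (φ : OrliczFunction) {u v : ℝ} (hu : 0 ≤ u) (huv : u < v) :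
    φ.rightSlope u ≤ (φ.toFun v - φ.toFun u) / (v - u) :=
  ciInf_le (f := fun v : Ioi u => (φ.toFun v - φ.toFun u) / (v - u))
    ⟨0, by
      rintro _ ⟨x, rfl⟩
      exact div_nonneg (sub_nonneg.2 (φ.mono hu x.2.le)) (sub_nonneg.2 x.2.le)⟩ ⟨v, huv⟩

theorem rightSlope_nonneg (φ : OrliczFunction) {u : ℝ} (hu : 0 ≤ u) : 0 ≤ φ.rightSlope u :=
  le_ciInf fun x => div_nonneg (sub_nonneg.2 (φ.mono hu x.2.le)) (sub_nonneg.2 x.2.le)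

theorem le_rightSlope (φ : OrliczFunction) {u v : ℝ} (hv : 0 ≤ v) (hvu : v < u) :
    (φ.toFun u - φ.toFun v) / (u - v) ≤ φ.rightSlope u :=
  le_ciInf fun x => φ.convexOn.slope_mono_adjacent (mem_Ici.2 hv)
    (mem_Ici.2 ((hv.trans hvu.le).trans x.2.le)) hvu x.2

theorem rightSlope_mono (φ : OrliczFunction) {u v : ℝ} (hu : 0 ≤ u) (huv : u ≤ v) :
    φ.rightSlope u ≤ φ.rightSlope v := by
  rcases huv.eq_or_lt with rfl | h
  · exact le_rfl
  · exact (φ.rightSlope_le hu h).trans (φ.le_rightSlope hu h)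

theorem measurable_rightSlope_abs (φ : OrliczFunction) :
    Measurable fun x : ℝ => φ.rightSlope |x| := by
  -- The slope is monotone only on `[0, ∞)`, as `φ.toFun` is arbitrary at negative reals; `max x 0`
  -- extends it monotonically and agrees with it on `|x|`.
  have h : Monotone fun x : ℝ => φ.rightSlope (max x 0) := fun x y hxy =>
    φ.rightSlope_mono (le_max_right _ _) (max_le_max_right 0 hxy)
  simpa [Function.comp_def] using h.measurable.comp (measurable_id.abs : Measurable fun x : ℝ => |x|)

/-- Any `q` between the left and the right derivative at `u` is a subgradient. -/
theorem isSubgradient (φ : OrliczFunction) {u q : ℝ} (hu : 0 ≤ u)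
    (h1 : ∀ c, 0 ≤ c → c < u → φ.rightSlope c ≤ q) (h2 : ∀ d, u < d → q ≤ φ.rightSlope d)
    {v : ℝ} (hv : 0 ≤ v) : v * q - φ.toFun v ≤ u * q - φ.toFun u := by
  rcases lt_trichotomy v u with h | rfl | h
  · have hc : ContinuousAt φ.toFun u :=
      ((φ.convexOn.subset Ioi_subset_Ici_self (convex_Ioi 0)).continuousOn isOpen_Ioi).continuousAt
        (Ioi_mem_nhds (hv.trans_lt h))
    have hl : Tendsto (fun c => q * (c - v) - φ.toFun c) (𝓝[<] u)
        (𝓝 (q * (u - v) - φ.toFun u)) := by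
      have : ContinuousAt (fun c => q * (c - v) - φ.toFun c) u := by fun_prop
      exact this.tendsto.mono_left nhdsWithin_le_nhds
    have := ge_of_tendsto (b := - φ.toFun v) hl (by
      filter_upwards [Ioo_mem_nhdsLT h] with c hc
      have := (φ.le_rightSlope hv hc.1).trans (h1 c (hv.trans hc.1.le) hc.2)
      rw [div_le_iff₀ (sub_pos.2 hc.1)] at this
      linarith)
    linarith
  · exact le_rfl
  -- No continuity of `φ` is needed on this side: `φ(u) ≤ φ(d)` by monotonicity, and only the linear
  -- term passes to the limit.
  · have hl : Tendsto (fun d => q * (v - d)) (𝓝[>] u) (𝓝 (q * (v - u))) := by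
      have : ContinuousAt (fun d => q * (v - d)) u := by fun_prop
      exact this.tendsto.mono_left nhdsWithin_le_nhds
    have := le_of_tendsto (b := φ.toFun v - φ.toFun u) hl (by
      filter_upwards [Ioo_mem_nhdsGT h] with d hd
      have := (h2 d hd.1).trans (φ.rightSlope_le (hu.trans hd.1.le) hd.2)
      rw [le_div_iff₀ (sub_pos.2 hd.2)] at this
      have := φ.mono hu hd.1.le
      linarith)
    linarith

/-- Equality in Young's inequality for subgradients. -/
theorem ext_add_compl_le_mul (φ : OrliczFunction) {u q : ℝ≥0∞} (hu : u ≠ ⊤) (hq : q ≠ ⊤)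
    (h1 : ∀ c : ℝ, 0 ≤ c → ENNReal.ofReal c < u → ENNReal.ofReal (φ.rightSlope c) ≤ q)
    (h2 : ∀ d : ℝ, u < ENNReal.ofReal d → q ≤ ENNReal.ofReal (φ.rightSlope d)) :
    φ.ext u + φ.compl q ≤ u * q := by
  lift u to ℝ≥0 using hu
  lift q to ℝ≥0 using hq
  have key : ∀ v : ℝ, 0 ≤ v → v * q - φ.toFun v ≤ u * q - φ.toFun u := fun v hv => by
    refine φ.isSubgradient u.coe_nonneg (fun c hc hcu => ?_) (fun d hd => ?_) hv
    · have := h1 c hc (by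
        rw [ENNReal.ofReal_lt_iff_lt_toReal hc ENNReal.coe_ne_top]; simpa using hcu)
      rw [ENNReal.ofReal_le_iff_le_toReal ENNReal.coe_ne_top] at this
      simpa using this
    · have := ENNReal.toReal_mono ENNReal.ofReal_ne_top (h2 d (by
        rw [ENNReal.lt_ofReal_iff_toReal_lt ENNReal.coe_ne_top]; simpa using hd))
      rw [ENNReal.toReal_ofReal (φ.rightSlope_nonneg (u.coe_nonneg.trans hd.le))] at this
      simpa using this
  have h0 : 0 ≤ (u : ℝ) * q - φ.toFun u := by simpa [φ.map_zero] using key 0 le_rfl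
  have hc : φ.compl q ≤ ENNReal.ofReal (u * q - φ.toFun u) := by
    refine iSup_le fun v => ?_
    rw [← ENNReal.ofReal_coe_nnreal (p := v), ← ENNReal.ofReal_coe_nnreal (p := q),
      ← ENNReal.ofReal_mul v.coe_nonneg, ← ENNReal.ofReal_sub _ (φ.nonneg v.coe_nonneg)]
    exact ENNReal.ofReal_le_ofReal (key v v.coe_nonneg)
  have hp := φ.nonneg u.coe_nonneg
  calc φ.ext u + φ.compl q
      ≤ ENNReal.ofReal (φ.toFun u) + ENNReal.ofReal (u * q - φ.toFun u) := by
        gcongr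
        simp [OrliczFunction.ext]
    _ = ENNReal.ofReal (u * q) := by
        rw [← ENNReal.ofReal_add hp h0]
        congr 1
        ring
    _ = _ := by rw [ENNReal.ofReal_mul u.coe_nonneg]; simp

end OrliczFunction

/-! ### Decreasing rearrangements -/

section Rearr

variable {α : Type*} [MeasurableSpace α] {μ : Measure α}

theorem rearr_le {f : α →ₘ[μ] ℝ} {c t : ℝ≥0∞} (h : distribution f c ≤ t) : rearr f t ≤ c :=
  sInf_le h

theorem lt_distribution {f : α →ₘ[μ] ℝ} {c t : ℝ≥0∞} (h : c < rearr f t) :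
    t < distribution f c :=
  lt_of_not_ge fun h' => (rearr_le h').not_gt h

theorem distribution_antitone (f : α →ₘ[μ] ℝ) : Antitone (distribution f) := fun _ _ hb =>
  measure_mono fun _ ha => lt_of_le_of_lt hb ha

theorem distribution_le {f : α →ₘ[μ] ℝ} {c t : ℝ≥0∞} (h : rearr f t < c) :
    distribution f c ≤ t := by
  obtain ⟨b, hb, hbc⟩ := sInf_lt_iff.1 h
  exact (distribution_antitone f hbc.le).trans hb

theorem le_rearr {f : α →ₘ[μ] ℝ} {c t : ℝ≥0∞} (h : t < μ {a | c ≤ ‖f a‖ₑ}) : c ≤ rearr f t := by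
  refine le_of_not_gt fun hc => ?_
  obtain ⟨b, hb, hbc⟩ := sInf_lt_iff.1 hc
  exact (h.trans_le ((measure_mono fun a (ha : c ≤ _) => hbc.trans_le ha).trans hb)).false

theorem rearr_mono {f g : α →ₘ[μ] ℝ} (H : ∀ᵐ a ∂μ, ‖f a‖ₑ ≤ ‖g a‖ₑ) (t : ℝ≥0∞) :
    rearr f t ≤ rearr g t := by
  refine le_of_forall_gt fun c hc => ?_
  obtain ⟨b, hb, hbc⟩ := sInf_lt_iff.1 hc
  refine lt_of_le_of_lt (rearr_le (le_trans (measure_mono_ae ?_) hb)) hbc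
  filter_upwards [H] with a ha
  exact fun h => lt_of_lt_of_le h ha

theorem enorm_smul_ae (c : ℝ) (f : α →ₘ[μ] ℝ) : ∀ᵐ a ∂μ, ‖(c • f) a‖ₑ = ‖c‖ₑ * ‖f a‖ₑ := by
  filter_upwards [AEEqFun.coeFn_smul c f] with a ha
  rw [ha, Pi.smul_apply, smul_eq_mul, enorm_mul]

theorem rearr_smul {c : ℝ} (hc : c ≠ 0) (f : α →ₘ[μ] ℝ) (t : ℝ≥0∞) :
    rearr (c • f) t = ‖c‖ₑ * rearr f t := by
  -- One inequality for all nonzero scalars suffices: applied to `c⁻¹` and `c • f`, it gives the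
  -- reverse one.
  have key : ∀ {c : ℝ} (_ : c ≠ 0) (f : α →ₘ[μ] ℝ), rearr (c • f) t ≤ ‖c‖ₑ * rearr f t := by
    intro c hc f
    have h0 : ‖c‖ₑ ≠ 0 := by simpa using hc
    rw [rearr.eq_1 f, sInf_eq_iInf, ENNReal.mul_iInf_of_ne h0 (by simp)]
    refine le_iInf fun b => ?_
    rw [ENNReal.mul_iInf_of_ne h0 (by simp)]
    refine le_iInf fun hb => rearr_le (le_trans (measure_mono_ae ?_) hb)
    filter_upwards [enorm_smul_ae c f] with a ha (h : _ < _)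
    rw [ha] at h
    exact lt_of_mul_lt_mul_left' h
  refine le_antisymm (key hc f) ?_
  have h := key (inv_ne_zero hc) (c • f)
  rw [smul_smul, inv_mul_cancel₀ hc, one_smul, enorm_inv hc] at h
  calc ‖c‖ₑ * rearr f t ≤ ‖c‖ₑ * (‖c‖ₑ⁻¹ * rearr (c • f) t) := by gcongr
    _ = _ := ENNReal.mul_inv_cancel_left (by simpa using hc) (by simp)

theorem rearr_le_of_enorm_le {f : α →ₘ[μ] ℝ} {M : ℝ≥0∞} (H : ∀ᵐ a ∂μ, ‖f a‖ₑ ≤ M) (t : ℝ≥0∞) :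
    rearr f t ≤ M := by
  refine rearr_le ?_
  have : distribution f M = 0 := by
    simpa only [distribution, ae_iff, not_le] using H
  simp [this]

theorem rearr_eq_zero {f : α →ₘ[μ] ℝ} {E : Set α} (H : ∀ᵐ a ∂μ, a ∉ E → f a = 0) {t : ℝ≥0∞}
    (ht : μ E ≤ t) : rearr f t = 0 := by
  refine le_antisymm (rearr_le (le_trans (measure_mono_ae ?_) ht)) bot_le
  filter_upwards [H] with a ha (h : _ < _)
  by_contra hE
  simp [ha hE] at h

end Rearr

/-! ### Modulars given by measures -/

/-- On decreasing functions, `J` is integration against a measure `ν` on `[0, ∞]` which is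
compatible with the underlying measure `μ`. -/
structure IsWeightMeasure {α : Type*} [MeasurableSpace α] (μ : Measure α)
    (J : (ℝ≥0∞ → ℝ≥0∞) → ℝ≥0∞) (ν : Measure ℝ≥0∞) : Prop where
  eq_lintegral : ∀ h : ℝ≥0∞ → ℝ≥0∞, Antitone h → J h = ∫⁻ t, h t ∂ν
  finite : ∀ T < ⊤, ν (Iio T) < ⊤
  infinite : μ univ = ⊤ → ν (Iio ⊤) = ⊤
  -- This turns convergence in measure into pointwise convergence of rearrangements, including at an
  -- atom of `ν` at `t = 0`, which occurs for sequences.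
  eventually_le : ∀ᵐ t ∂ν, ∀ A : ℕ → Set α, Tendsto (fun n => μ (A n)) atTop (𝓝 0) →
    ∀ᶠ n in atTop, μ (A n) ≤ t

section Modular

variable {α : Type*} [MeasurableSpace α] {μ : Measure α} {J : (ℝ≥0∞ → ℝ≥0∞) → ℝ≥0∞}
  {ν : Measure ℝ≥0∞} {φ : OrliczFunction}

theorem antitone_ext_rearr (φ : OrliczFunction) (f : α →ₘ[μ] ℝ) :
    Antitone fun t => φ.ext (rearr f t) :=
  φ.ext_mono.comp_antitone (rearr_antitone f)

theorem antitone_compl_rearr (φ : OrliczFunction) (f : α →ₘ[μ] ℝ) :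
    Antitone fun t => φ.compl (rearr f t) :=
  φ.compl_mono.comp_antitone (rearr_antitone f)

theorem antitone_rearr_mul_rearr (f g : α →ₘ[μ] ℝ) :
    Antitone fun t => rearr f t * rearr g t :=
  (rearr_antitone f).mul' (rearr_antitone g)

namespace IsWeightMeasure

theorem modular_eq (hν : IsWeightMeasure μ J ν) (φ : OrliczFunction) (f : α →ₘ[μ] ℝ) :
    modular J φ.ext f = ∫⁻ t, φ.ext (rearr f t) ∂ν :=
  hν.eq_lintegral _ (antitone_ext_rearr φ f)

theorem modular_compl_eq (hν : IsWeightMeasure μ J ν) (φ : OrliczFunction) (f : α →ₘ[μ] ℝ) :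
    modular J φ.compl f = ∫⁻ t, φ.compl (rearr f t) ∂ν :=
  hν.eq_lintegral _ (antitone_compl_rearr φ f)

theorem modular_mono (hν : IsWeightMeasure μ J ν) (φ : OrliczFunction) {f g : α →ₘ[μ] ℝ}
    (H : ∀ᵐ a ∂μ, ‖f a‖ₑ ≤ ‖g a‖ₑ) : modular J φ.ext f ≤ modular J φ.ext g := by
  rw [hν.modular_eq, hν.modular_eq]
  exact lintegral_mono fun t => φ.ext_mono (rearr_mono H t)

theorem modular_smul_mono (hν : IsWeightMeasure μ J ν) (φ : OrliczFunction) {c d : ℝ}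
    (hc : 0 ≤ c) (hcd : c ≤ d) (f : α →ₘ[μ] ℝ) :
    modular J φ.ext (c • f) ≤ modular J φ.ext (d • f) := by
  refine hν.modular_mono φ ?_
  filter_upwards [enorm_smul_ae c f, enorm_smul_ae d f] with a h1 h2
  rw [h1, h2, Real.enorm_of_nonneg hc, Real.enorm_of_nonneg (hc.trans hcd)]
  gcongr

/-- If `|f| > c` on a set of infinite measure, then `f^* ≥ c` at every finite `t`, and `ν` has
infinite mass there, so the modular would be infinite. -/
theorem distribution_lt_top (hν : IsWeightMeasure μ J ν) {f : α →ₘ[μ] ℝ}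
    (hf : modular J φ.ext f < ⊤) {c : ℝ≥0∞} (hc : 0 < c) : distribution f c < ⊤ := by
  by_contra! h
  rw [top_le_iff] at h
  have hμ : μ univ = ⊤ := top_le_iff.1 (h ▸ measure_mono (subset_univ _))
  have h1 : ∀ t ∈ Iio (⊤ : ℝ≥0∞), φ.ext c ≤ φ.ext (rearr f t) := fun t ht =>
    φ.ext_mono (le_of_not_gt fun h' => (distribution_le h').not_gt (h ▸ ht))
  have h2 : φ.ext c * ν (Iio ⊤) ≤ modular J φ.ext f := by
    rw [hν.modular_eq, ← setLIntegral_const]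
    exact (setLIntegral_mono_ae' measurableSet_Iio (Eventually.of_forall h1)).trans
      (setLIntegral_le_lintegral _ _)
  rw [hν.infinite hμ, ENNReal.mul_top (φ.ext_pos hc).ne'] at h2
  exact hf.not_ge h2

/-- Dominated convergence for modulars. -/
theorem tendsto_modular_zero (hν : IsWeightMeasure μ J ν) {f : α →ₘ[μ] ℝ}
    (hf : modular J φ.ext f < ⊤) {x : ℕ → α →ₘ[μ] ℝ} (hx : ∀ n, ∀ᵐ a ∂μ, ‖x n a‖ₑ ≤ ‖f a‖ₑ)
    (h0 : ∀ᵐ a ∂μ, Tendsto (fun n => x n a) atTop (𝓝 0)) :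
    Tendsto (fun n => modular J φ.ext (x n)) atTop (𝓝 0) := by
  -- Domination confines `{|xₙ| > c}` to `{|f| > c}`, a set of finite measure, so convergence a.e.
  -- implies convergence in measure.
  have hd : ∀ c : ℝ≥0∞, 0 < c → Tendsto (fun n => distribution (x n) c) atTop (𝓝 0) := by
    intro c hc
    have hm : ∀ g : α →ₘ[μ] ℝ, MeasurableSet {a | c < ‖g a‖ₑ} := fun g =>
      measurableSet_lt measurable_const g.measurable.enorm
    have := tendsto_measure_of_ae_tendsto_indicator (μ := μ) atTop MeasurableSet.empty
      (As := fun n => {a | c < ‖x n a‖ₑ} ∩ {a | c < ‖f a‖ₑ}) (fun n => (hm _).inter (hm f)) (hm f)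
      (hν.distribution_lt_top hf hc).ne (Eventually.of_forall fun n => inter_subset_right) (by
        filter_upwards [h0] with a ha
        have h1 : Tendsto (fun n => ‖x n a‖ₑ) atTop (𝓝 0) := by simpa using ha.enorm
        filter_upwards [h1.eventually_le_const hc] with n hn
        simpa using fun h => absurd hn (not_le.2 h))
    rw [measure_empty] at this
    refine this.congr fun n => measure_congr ?_
    filter_upwards [hx n] with a ha
    apply propext
    exact ⟨fun h => h.1, fun h => ⟨h, lt_of_lt_of_le h ha⟩⟩
  simp only [hν.modular_eq] at hf ⊢
  have key := tendsto_lintegral_of_dominated_convergence (μ := ν) (f := fun _ => 0)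
    (F := fun n t => φ.ext (rearr (x n) t)) (fun t => φ.ext (rearr f t))
    (fun n => (antitone_ext_rearr φ _).measurable)
    (fun n => Eventually.of_forall fun t => φ.ext_mono (rearr_mono (hx n) t)) hf.ne (by
      filter_upwards [hν.eventually_le] with t ht
      refine φ.tendsto_ext_zero.comp ?_
      rw [ENNReal.tendsto_nhds_zero]
      intro c hc
      filter_upwards [ht _ (hd c hc)] with n hn
      exact rearr_le hn)
  simpa using key

end IsWeightMeasure

/-! ### The Luxemburg norm and the Orlicz norm -/

theorem luxemburgNorm_le {f : α →ₘ[μ] ℝ} {ε : ℝ} (hε : 0 < ε)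
    (h : modular J φ.ext (ε⁻¹ • f) ≤ 1) : luxemburgNorm J φ f ≤ ENNReal.ofReal ε :=
  iInf₂_le ε ⟨hε, h⟩

theorem exists_modular_le_one_of_luxemburgNorm_lt {f : α →ₘ[μ] ℝ} {r : ℝ≥0∞}
    (h : luxemburgNorm J φ f < r) :
    ∃ ε : ℝ, 0 < ε ∧ ENNReal.ofReal ε < r ∧ modular J φ.ext (ε⁻¹ • f) ≤ 1 := by
  simp only [luxemburgNorm, iInf_lt_iff] at h
  obtain ⟨ε, h1, h2⟩ := h
  exact ⟨ε, h1.1, h2, h1.2⟩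

namespace IsWeightMeasure

/-- Young's inequality, integrated. The constant `1` is exactly what makes functions of small
modular have Orlicz norm close to at most `1`. -/
theorem orliczNorm_le_one_add (hν : IsWeightMeasure μ J ν) (φ : OrliczFunction)
    (f : α →ₘ[μ] ℝ) : orliczNorm J φ f ≤ 1 + modular J φ.ext f := by
  refine iSup₂_le fun g hg => ?_
  rw [hν.modular_compl_eq] at hg
  rw [hν.eq_lintegral _ (antitone_rearr_mul_rearr f g), hν.modular_eq, add_comm]
  refine (lintegral_mono fun t => φ.mul_le_ext_add_compl _ _).trans ?_
  rw [lintegral_add_left (antitone_ext_rearr φ f).measurable]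
  gcongr

theorem orliczNorm_mono (hν : IsWeightMeasure μ J ν) (φ : OrliczFunction) {f g : α →ₘ[μ] ℝ}
    (H : ∀ᵐ a ∂μ, ‖f a‖ₑ ≤ ‖g a‖ₑ) : orliczNorm J φ f ≤ orliczNorm J φ g := by
  refine iSup₂_mono fun k _ => ?_
  rw [hν.eq_lintegral _ (antitone_rearr_mul_rearr _ _),
    hν.eq_lintegral _ (antitone_rearr_mul_rearr _ _)]
  exact lintegral_mono fun t => mul_le_mul' (rearr_mono H t) le_rfl

theorem orliczNorm_smul (hν : IsWeightMeasure μ J ν) (φ : OrliczFunction) {c : ℝ} (hc : c ≠ 0)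
    (f : α →ₘ[μ] ℝ) : orliczNorm J φ (c • f) = ‖c‖ₑ * orliczNorm J φ f := by
  unfold orliczNorm
  simp only [ENNReal.mul_iSup]
  refine iSup_congr fun g => iSup_congr fun _ => ?_
  rw [hν.eq_lintegral _ (antitone_rearr_mul_rearr _ _),
    hν.eq_lintegral _ (antitone_rearr_mul_rearr _ _),
    ← lintegral_const_mul _ (antitone_rearr_mul_rearr _ _).measurable]
  simp only [rearr_smul hc, mul_assoc]

theorem orliczNorm_le_two_mul (hν : IsWeightMeasure μ J ν) (φ : OrliczFunction)
    (f : α →ₘ[μ] ℝ) : orliczNorm J φ f ≤ 2 * luxemburgNorm J φ f := by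
  refine ENNReal.le_mul_of_forall_lt (Or.inl two_ne_zero) (Or.inl ENNReal.ofNat_ne_top) ?_
  intro a ha b hb
  obtain ⟨ε, hε, hεb, h⟩ := exists_modular_le_one_of_luxemburgNorm_lt hb
  have h1 := hν.orliczNorm_le_one_add φ (ε⁻¹ • f)
  rw [hν.orliczNorm_smul φ (inv_ne_zero hε.ne')] at h1
  have h2 : ‖ε⁻¹‖ₑ * orliczNorm J φ f ≤ 2 := by
    refine h1.trans ?_
    rw [← one_add_one_eq_two]
    gcongr
  rw [enorm_inv hε.ne', ENNReal.inv_mul_le_iff (by simpa using hε.ne') (by simp),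
    Real.enorm_of_nonneg hε.le, mul_comm] at h2
  exact h2.trans (mul_le_mul' ha.le hεb.le)

end IsWeightMeasure

/-! ### Truncations -/

/-- The truncation of `f` to a set of finite measure on which `|f| ≤ n`. -/
noncomputable def trunc [SigmaFinite μ] (f : α →ₘ[μ] ℝ) (n : ℕ) : α →ₘ[μ] ℝ :=
  AEEqFun.mk ((spanningSets μ n ∩ {a | |f a| ≤ n}).indicator f)
    (f.measurable.indicator ((measurableSet_spanningSets μ n).inter
      (measurableSet_le f.measurable.abs measurable_const))).aestronglyMeasurable

section Trunc

variable [SigmaFinite μ]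

theorem coeFn_trunc (f : α →ₘ[μ] ℝ) (n : ℕ) :
    trunc f n =ᵐ[μ] (spanningSets μ n ∩ {a | |f a| ≤ n}).indicator f :=
  AEEqFun.coeFn_mk _ _

theorem enorm_trunc_le (f : α →ₘ[μ] ℝ) (n : ℕ) : ∀ᵐ a ∂μ, ‖trunc f n a‖ₑ ≤ ‖f a‖ₑ := by
  filter_upwards [coeFn_trunc f n] with a ha
  rw [ha]
  exact enorm_indicator_le_enorm_self _ _

theorem enorm_trunc_le_natCast (f : α →ₘ[μ] ℝ) (n : ℕ) :
    ∀ᵐ a ∂μ, ‖trunc f n a‖ₑ ≤ n := by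
  filter_upwards [coeFn_trunc f n] with a ha
  rw [ha]
  by_cases h : a ∈ spanningSets μ n ∩ {a | |f a| ≤ n}
  · rw [indicator_of_mem h, Real.enorm_eq_ofReal_abs]
    exact (ENNReal.ofReal_le_ofReal h.2).trans (by simp)
  · simp [indicator_of_notMem h]

theorem trunc_eq_zero (f : α →ₘ[μ] ℝ) (n : ℕ) :
    ∀ᵐ a ∂μ, a ∉ spanningSets μ n → trunc f n a = 0 := by
  filter_upwards [coeFn_trunc f n] with a ha h
  rw [ha]
  exact indicator_of_notMem (fun h' => h h'.1) _

theorem exists_mem_truncSet (f : α →ₘ[μ] ℝ) (a : α) :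
    ∃ N : ℕ, ∀ n ≥ N, a ∈ spanningSets μ n ∩ {a | |f a| ≤ n} := by
  obtain ⟨k, hk⟩ := exists_nat_ge |f a|
  refine ⟨max k (spanningSetsIndex μ a), fun n hn => ⟨?_, ?_⟩⟩
  · exact monotone_spanningSets μ ((le_max_right _ _).trans hn) (mem_spanningSetsIndex μ a)
  · exact hk.trans (by exact_mod_cast (le_max_left _ _).trans hn)

theorem monotone_truncSet (f : α →ₘ[μ] ℝ) :
    Monotone fun n : ℕ => spanningSets μ n ∩ {a | |f a| ≤ n} := fun m n hmn =>
  inter_subset_inter (monotone_spanningSets μ hmn) fun a (ha : |f a| ≤ m) =>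
    ha.trans (by exact_mod_cast hmn : (m : ℝ) ≤ n)

theorem tendsto_sub_trunc (f : α →ₘ[μ] ℝ) :
    ∀ᵐ a ∂μ, Tendsto (fun n => (f - trunc f n) a) atTop (𝓝 0) := by
  filter_upwards [ae_all_iff.2 fun n => coeFn_trunc f n,
    ae_all_iff.2 fun n => AEEqFun.coeFn_sub f (trunc f n)] with a h1 h2
  obtain ⟨N, hN⟩ := exists_mem_truncSet f a
  refine tendsto_const_nhds.congr' ?_
  filter_upwards [eventually_ge_atTop N] with n hn
  rw [h2, Pi.sub_apply, h1, indicator_of_mem (hN n hn), sub_self]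

theorem enorm_sub_trunc_le (f : α →ₘ[μ] ℝ) (n : ℕ) :
    ∀ᵐ a ∂μ, ‖(f - trunc f n) a‖ₑ ≤ ‖f a‖ₑ := by
  filter_upwards [coeFn_trunc f n, AEEqFun.coeFn_sub f (trunc f n)] with a h1 h2
  rw [h2, Pi.sub_apply, h1]
  by_cases h : a ∈ spanningSets μ n ∩ {a | |f a| ≤ n}
  · simp [indicator_of_mem h]
  · simp [indicator_of_notMem h]

/-- The rearrangements of the truncations increase to the rearrangement. -/
theorem eventually_le_rearr_trunc {f : α →ₘ[μ] ℝ} {b t : ℝ≥0∞} (h : b < rearr f t) :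
    ∀ᶠ n in atTop, b ≤ rearr (trunc f n) t := by
  have hmono : Monotone fun n : ℕ =>
      {a | b < ‖f a‖ₑ} ∩ (spanningSets μ n ∩ {a | |f a| ≤ n}) := fun m n hmn =>
    inter_subset_inter_right _ (monotone_truncSet f hmn)
  have hU : ⋃ n : ℕ, {a | b < ‖f a‖ₑ} ∩ (spanningSets μ n ∩ {a | |f a| ≤ n}) =
      {a | b < ‖f a‖ₑ} := by
    refine subset_antisymm (iUnion_subset fun n => inter_subset_left) fun a ha => ?_
    obtain ⟨N, hN⟩ := exists_mem_truncSet f a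
    exact mem_iUnion.2 ⟨N, ha, hN N le_rfl⟩
  have h1 := tendsto_measure_iUnion_atTop (μ := μ) hmono
  rw [hU] at h1
  filter_upwards [h1.eventually_const_lt (lt_distribution h)] with n hn
  refine le_rearr (hn.trans_le (measure_mono_ae ?_))
  filter_upwards [coeFn_trunc f n] with a ha hm
  change b ≤ ‖trunc f n a‖ₑ
  rw [ha, indicator_of_mem hm.2]
  exact (show b < ‖f a‖ₑ from hm.1).le

end Trunc

namespace IsWeightMeasure

/-- A bounded function supported by a set of finite measure has finite modular. -/
theorem modular_lt_top_of_bounded (hν : IsWeightMeasure μ J ν) (φ : OrliczFunction)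
    {f : α →ₘ[μ] ℝ} {M : ℝ≥0∞} (hM : M < ⊤) (H : ∀ᵐ a ∂μ, ‖f a‖ₑ ≤ M) {E : Set α}
    (hE : μ E < ⊤) (HE : ∀ᵐ a ∂μ, a ∉ E → f a = 0) : modular J φ.ext f < ⊤ := by
  have h : ∀ t, φ.ext (rearr f t) ≤ (Iio (μ E)).indicator (fun _ => φ.ext M) t := fun t => by
    by_cases ht : t < μ E
    · rw [indicator_of_mem (mem_Iio.2 ht)]
      exact φ.ext_mono (rearr_le_of_enorm_le H t)
    · rw [rearr_eq_zero HE (not_lt.1 ht), φ.ext_zero]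
      exact bot_le
  rw [hν.modular_eq]
  refine (lintegral_mono h).trans_lt ?_
  rw [lintegral_indicator measurableSet_Iio, setLIntegral_const]
  exact ENNReal.mul_lt_top (φ.ext_lt_top hM) (hν.finite _ hE)

theorem modular_smul_trunc_lt_top [SigmaFinite μ] (hν : IsWeightMeasure μ J ν)
    (φ : OrliczFunction) (c : ℝ) (f : α →ₘ[μ] ℝ) (n : ℕ) :
    modular J φ.ext (c • trunc f n) < ⊤ := by
  refine hν.modular_lt_top_of_bounded φ (M := ‖c‖ₑ * n) (E := spanningSets μ n)
    (ENNReal.mul_lt_top (by simp) (by simp)) ?_ (measure_spanningSets_lt_top μ n) ?_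
  · filter_upwards [enorm_smul_ae c (trunc f n), enorm_trunc_le_natCast f n] with a h1 h2
    rw [h1]
    gcongr
  · filter_upwards [AEEqFun.coeFn_smul c (trunc f n), trunc_eq_zero f n] with a h1 h2 h3
    rw [h1, Pi.smul_apply, h2 h3, smul_zero]

end IsWeightMeasure

/-! ### The Orlicz norm dominates the Luxemburg norm -/

/-- The function `p(|f|)`, where `p` is the right derivative of `φ`. -/
noncomputable def subgradientFun (φ : OrliczFunction) (f : α →ₘ[μ] ℝ) : α →ₘ[μ] ℝ :=
  AEEqFun.compMeasurable (fun x => φ.rightSlope |x|) φ.measurable_rightSlope_abs f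

theorem enorm_subgradientFun (φ : OrliczFunction) (f : α →ₘ[μ] ℝ) :
    ∀ᵐ a ∂μ, ‖subgradientFun φ f a‖ₑ = ENNReal.ofReal (φ.rightSlope |f a|) := by
  filter_upwards [AEEqFun.coeFn_compMeasurable _ φ.measurable_rightSlope_abs f] with a ha
  rw [subgradientFun, ha, Function.comp_apply,
    Real.enorm_of_nonneg (φ.rightSlope_nonneg (abs_nonneg _))]

theorem le_rearr_subgradientFun {f : α →ₘ[μ] ℝ} {c : ℝ} {t : ℝ≥0∞} (hc : 0 ≤ c)
    (h : ENNReal.ofReal c < rearr f t) :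
    ENNReal.ofReal (φ.rightSlope c) ≤ rearr (subgradientFun φ f) t := by
  refine le_rearr ((lt_distribution h).trans_le (measure_mono_ae ?_))
  filter_upwards [enorm_subgradientFun φ f] with a ha (hlt : _ < _)
  change _ ≤ ‖_‖ₑ
  rw [ha]
  refine ENNReal.ofReal_le_ofReal (φ.rightSlope_mono hc ?_)
  rw [Real.enorm_eq_ofReal_abs] at hlt
  exact (ENNReal.lt_ofReal_iff_toReal_lt ENNReal.ofReal_ne_top |>.1 hlt |>.le).trans'
    (ENNReal.toReal_ofReal hc).ge

theorem rearr_subgradientFun_le {f : α →ₘ[μ] ℝ} {d : ℝ} {t : ℝ≥0∞}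
    (h : rearr f t < ENNReal.ofReal d) :
    rearr (subgradientFun φ f) t ≤ ENNReal.ofReal (φ.rightSlope d) := by
  refine rearr_le (le_trans (measure_mono_ae ?_) (distribution_le h))
  filter_upwards [enorm_subgradientFun φ f] with a ha (hlt : _ < _)
  rw [ha] at hlt
  change ENNReal.ofReal d < ‖f a‖ₑ
  rw [Real.enorm_eq_ofReal_abs]
  by_contra! hle
  have hd : 0 < d := ENNReal.ofReal_pos.1 (bot_le.trans_lt h)
  exact hlt.not_ge (ENNReal.ofReal_le_ofReal (φ.rightSlope_mono (abs_nonneg _)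
    ((ENNReal.ofReal_le_ofReal_iff hd.le).1 hle)))

namespace IsWeightMeasure

/-- With `g = p(|f|)`, equality in Young's inequality gives `ρ(f) + ρ_*(g) ≤ J (f^* g^*)`. If
`ρ_*(g) ≤ 1`, then `g` is an admissible test function. Otherwise, with `R = ρ_*(g)`, `g / R` is
admissible, so `J (f^* g^*) ≤ R` and even `ρ(f) = 0`. Boundedness and finite support ensure `R < ∞`,
which this cancellation requires. -/
theorem modular_le_one_of_bounded (hν : IsWeightMeasure μ J ν) {f : α →ₘ[μ] ℝ} {M : ℝ}
    (H : ∀ᵐ a ∂μ, ‖f a‖ₑ ≤ ENNReal.ofReal M) {E : Set α}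
    (hE : μ E < ⊤) (HE : ∀ᵐ a ∂μ, a ∉ E → f a = 0) (hf : orliczNorm J φ f ≤ 1) :
    modular J φ.ext f ≤ 1 := by
  set g := subgradientFun φ f with hg
  have hfM : ∀ t, rearr f t ≤ ENNReal.ofReal M := rearr_le_of_enorm_le H
  -- The bound on `g^*` requires a level strictly above `f^*`, hence the `+ 1`; `max M 0` allows
  -- negative `M`.
  have hgM : ∀ t, rearr g t ≤ ENNReal.ofReal (φ.rightSlope (max M 0 + 1)) := fun t =>
    rearr_subgradientFun_le ((hfM t).trans_lt ((ENNReal.ofReal_lt_ofReal_iff (by positivity)).2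
      ((le_max_left _ _).trans_lt (lt_add_one _))))
  -- At a jump of `p`, `g^*(t)` need not equal `p(f^*(t))`, but it lies between the slopes on either
  -- side of `f^*(t)`, which is enough for a subgradient.
  have hy : ∀ t, φ.ext (rearr f t) + φ.compl (rearr g t) ≤ rearr f t * rearr g t := fun t =>
    φ.ext_add_compl_le_mul (ne_top_of_le_ne_top ENNReal.ofReal_ne_top (hfM t))
      (ne_top_of_le_ne_top ENNReal.ofReal_ne_top (hgM t))
      (fun c hc h => le_rearr_subgradientFun hc h) (fun d h => rearr_subgradientFun_le h)
  have hsum : modular J φ.ext f + modular J φ.compl g ≤ J fun t => rearr f t * rearr g t := by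
    rw [hν.modular_eq, hν.modular_compl_eq, hν.eq_lintegral _ (antitone_rearr_mul_rearr f g),
      ← lintegral_add_left (antitone_ext_rearr φ f).measurable]
    exact lintegral_mono hy
  rcases le_or_gt (modular J φ.compl g) 1 with h1 | h1
  · exact le_self_add.trans (hsum.trans ((le_iSup₂ (f := fun (g : α →ₘ[μ] ℝ)
      (_ : modular J φ.compl g ≤ 1) => J fun t => rearr f t * rearr g t) g h1).trans hf))
  set R := modular J φ.compl g with hR
  have hRtop : R < ⊤ := by
    have h : ∀ t, rearr f t * rearr g t ≤ (Iio (μ E)).indicator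
        (fun _ => ENNReal.ofReal M * ENNReal.ofReal (φ.rightSlope (max M 0 + 1))) t := fun t => by
      by_cases ht : t < μ E
      · rw [indicator_of_mem (mem_Iio.2 ht)]
        exact mul_le_mul' (hfM t) (hgM t)
      · rw [rearr_eq_zero HE (not_lt.1 ht), zero_mul]
        exact bot_le
    refine (le_add_self.trans hsum).trans_lt ?_
    rw [hν.eq_lintegral _ (antitone_rearr_mul_rearr f g)]
    refine (lintegral_mono h).trans_lt ?_
    rw [lintegral_indicator measurableSet_Iio, setLIntegral_const]
    exact ENNReal.mul_lt_top (ENNReal.mul_lt_top ENNReal.ofReal_lt_top ENNReal.ofReal_lt_top)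
      (hν.finite _ hE)
  have hR0 : R ≠ 0 := (zero_lt_one.trans h1).ne'
  have hr0 : 0 < R.toReal := ENNReal.toReal_pos hR0 hRtop.ne
  have hen : ‖R.toReal⁻¹‖ₑ = R⁻¹ := by
    rw [enorm_inv hr0.ne', Real.enorm_of_nonneg hr0.le, ENNReal.ofReal_toReal hRtop.ne]
  have hre : ∀ t, rearr (R.toReal⁻¹ • g) t = R⁻¹ * rearr g t := fun t => by
    rw [rearr_smul (inv_ne_zero hr0.ne'), hen]
  have h2 : modular J φ.compl (R.toReal⁻¹ • g) ≤ 1 := by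
    rw [hν.modular_compl_eq]
    calc ∫⁻ t, φ.compl (rearr (R.toReal⁻¹ • g) t) ∂ν
        ≤ ∫⁻ t, R⁻¹ * φ.compl (rearr g t) ∂ν := lintegral_mono fun t => by
          rw [hre]
          exact φ.compl_inv_mul_le h1.le _
      _ = R⁻¹ * R := by
          rw [lintegral_const_mul _ (antitone_compl_rearr φ g).measurable, hR, hν.modular_compl_eq]
      _ = 1 := ENNReal.inv_mul_cancel hR0 hRtop.ne
  have h3 : R⁻¹ * (J fun t => rearr f t * rearr g t) ≤ 1 := by
    refine le_trans (le_of_eq ?_) ((le_iSup₂ (f := fun (g : α →ₘ[μ] ℝ)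
      (_ : modular J φ.compl g ≤ 1) => J fun t => rearr f t * rearr g t) _ h2).trans hf)
    rw [hν.eq_lintegral _ (antitone_rearr_mul_rearr f g),
      hν.eq_lintegral _ (antitone_rearr_mul_rearr f _),
      ← lintegral_const_mul _ (antitone_rearr_mul_rearr f g).measurable]
    simp only [hre, mul_left_comm]
  rw [ENNReal.inv_mul_le_iff hR0 hRtop.ne, mul_one] at h3
  have h4 : modular J φ.ext f + R ≤ 0 + R := by rw [zero_add]; exact hsum.trans h3
  exact ((ENNReal.add_le_add_iff_right hRtop.ne).1 h4).trans zero_le_one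

variable [SigmaFinite μ]

/-- Truncations have modular at most `1` by the bounded case. Where `0 < f^* < ∞`, the strict
inequality `c f^* < f^*` puts their rearrangements eventually above `c f^*`, and Fatou's lemma
concludes. -/
theorem modular_smul_le_one (hν : IsWeightMeasure μ J ν) {f : α →ₘ[μ] ℝ}
    (hfX : f ∈ spaceCarrier μ J φ) (hf : orliczNorm J φ f ≤ 1) {c : ℝ} (hc : 0 < c)
    (hc1 : c < 1) : modular J φ.ext (c • f) ≤ 1 := by
  have htr : ∀ n, modular J φ.ext (trunc f n) ≤ 1 := fun n =>
    hν.modular_le_one_of_bounded (M := n) (by simpa using enorm_trunc_le_natCast f n)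
      (measure_spanningSets_lt_top μ n) (trunc_eq_zero f n)
      ((hν.orliczNorm_mono φ (enorm_trunc_le f n)).trans hf)
  obtain ⟨b, hb, hfb⟩ := hfX
  -- Membership in the space excludes `f^* = ∞`, where `c f^* < f^*` would fail.
  have hfin : ∀ᵐ t ∂ν, rearr f t < ⊤ := by
    rw [hν.modular_eq] at hfb
    filter_upwards [ae_lt_top (antitone_ext_rearr φ (b • f)).measurable hfb.ne] with t ht
    by_contra! h
    rw [rearr_smul hb.ne', top_le_iff.1 h, ENNReal.mul_top (by simpa using hb.ne')] at ht
    simp [OrliczFunction.ext] at ht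
  simp only [hν.modular_eq] at htr ⊢
  calc ∫⁻ t, φ.ext (rearr (c • f) t) ∂ν
      ≤ ∫⁻ t, liminf (fun n => φ.ext (rearr (trunc f n) t)) atTop ∂ν := by
        refine lintegral_mono_ae ?_
        filter_upwards [hfin] with t ht
        refine le_liminf_of_le (by isBoundedDefault) ?_
        rw [rearr_smul hc.ne']
        rcases eq_or_ne (rearr f t) 0 with h0 | h0
        · simp [h0, φ.ext_zero]
        · have hlt : ‖c‖ₑ * rearr f t < rearr f t := by
            conv_rhs => rw [← one_mul (rearr f t)]
            refine ENNReal.mul_lt_mul_left h0 ht.ne ?_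
            rw [Real.enorm_of_nonneg hc.le]
            simpa using hc1
          filter_upwards [eventually_le_rearr_trunc hlt] with n hn
          exact φ.ext_mono hn
    _ ≤ liminf (fun n => ∫⁻ t, φ.ext (rearr (trunc f n) t) ∂ν) atTop :=
        lintegral_liminf_le fun n => (antitone_ext_rearr φ _).measurable
    _ ≤ 1 := (liminf_le_liminf (Eventually.of_forall htr)).trans (by simp)

theorem luxemburgNorm_le_orliczNorm (hν : IsWeightMeasure μ J ν) {f : α →ₘ[μ] ℝ}
    (hfX : f ∈ spaceCarrier μ J φ) : luxemburgNorm J φ f ≤ orliczNorm J φ f := by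
  refine le_of_forall_gt fun e he => ?_
  obtain ⟨r, h1, h2⟩ := ENNReal.lt_iff_exists_nnreal_btwn.1 he
  obtain ⟨δ, h3, h4⟩ := ENNReal.lt_iff_exists_nnreal_btwn.1 h1
  refine lt_of_le_of_lt ?_ h2
  have hδ : 0 < (δ : ℝ) := by
    have : (0 : ℝ≥0∞) < δ := bot_le.trans_lt h3
    exact_mod_cast this
  have hδr : (δ : ℝ) < r := by exact_mod_cast h4
  have hr : (0 : ℝ) < r := hδ.trans hδr
  have h5 : orliczNorm J φ ((δ : ℝ)⁻¹ • f) ≤ 1 := by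
    rw [hν.orliczNorm_smul φ (inv_ne_zero hδ.ne'), enorm_inv hδ.ne',
      ENNReal.inv_mul_le_iff (by simpa using hδ.ne') (by simp), mul_one]
    simpa using h3.le
  have hmem : (δ : ℝ)⁻¹ • f ∈ spaceCarrier μ J φ := by
    obtain ⟨b, hb, hfb⟩ := hfX
    refine ⟨b * δ, by positivity, ?_⟩
    rwa [smul_smul, mul_assoc, mul_inv_cancel₀ hδ.ne', mul_one]
  -- `f / δ` has Orlicz norm at most `1`; the gap `δ < r` supplies the factor `δ / r < 1`, which
  -- turns it into `f / r`.
  have h6 := hν.modular_smul_le_one hmem h5 (c := δ / r) (by positivity) ((div_lt_one hr).2 hδr)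
  rw [smul_smul, div_mul_eq_mul_div, mul_inv_cancel₀ hδ.ne', one_div] at h6
  simpa using luxemburgNorm_le hr h6

end IsWeightMeasure

end Modular

/-! ### Order-continuous elements and singular functionals -/

section Dual

variable {α : Type*} [MeasurableSpace α] {μ : Measure α} {J : (ℝ≥0∞ → ℝ≥0∞) → ℝ≥0∞}
  {ν : Measure ℝ≥0∞} {φ : OrliczFunction}

theorem enorm_le_of_le_abs {f x : α →ₘ[μ] ℝ} (h0 : 0 ≤ x) (h1 : x ≤ |f|) :
    ∀ᵐ a ∂μ, ‖x a‖ₑ ≤ ‖f a‖ₑ := by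
  filter_upwards [AEEqFun.coeFn_le.2 h0, AEEqFun.coeFn_le.2 h1, AEEqFun.coeFn_abs f,
    AEEqFun.coeFn_zero (α := α) (μ := μ) (β := ℝ)] with a h2 h3 h4 h5
  rw [h5, Pi.zero_apply] at h2
  rw [h4] at h3
  rw [Real.enorm_of_nonneg h2, Real.enorm_eq_ofReal_abs]
  exact ENNReal.ofReal_le_ofReal h3

namespace IsWeightMeasure

theorem mem_spaceCarrier_of_enorm_le (hν : IsWeightMeasure μ J ν) {f x : α →ₘ[μ] ℝ}
    (hf : f ∈ spaceCarrier μ J φ) (h : ∀ᵐ a ∂μ, ‖x a‖ₑ ≤ ‖f a‖ₑ) : x ∈ spaceCarrier μ J φ := by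
  obtain ⟨c, hc, hfc⟩ := hf
  refine ⟨c, hc, (hν.modular_mono φ ?_).trans_lt hfc⟩
  filter_upwards [enorm_smul_ae c f, enorm_smul_ae c x, h] with a h1 h2 h3
  rw [h1, h2]
  gcongr

/-- For each fixed `ε`, dominated convergence under `f / ε` makes the modular of `xₙ / ε` eventually
at most `1`, that is, the norm of `xₙ` at most `ε`. -/
theorem isOrderContinuous_of_modular_lt_top (hν : IsWeightMeasure μ J ν) {f : α →ₘ[μ] ℝ}
    (hf : ∀ ε : ℝ, 0 < ε → modular J φ.ext (ε⁻¹ • f) < ⊤) :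
    IsOrderContinuous (luxemburgNorm J φ) f := by
  intro x hx _ h0
  rw [ENNReal.tendsto_nhds_zero]
  intro e he
  obtain ⟨ε, hε, hεe⟩ : ∃ ε : ℝ, 0 < ε ∧ ENNReal.ofReal ε ≤ e := by
    obtain ⟨r, h1, h2⟩ := ENNReal.lt_iff_exists_nnreal_btwn.1 he
    exact ⟨r, by exact_mod_cast h1, by simpa using h2.le⟩
  have hle : ∀ n, ∀ᵐ a ∂μ, ‖(ε⁻¹ • x n) a‖ₑ ≤ ‖(ε⁻¹ • f) a‖ₑ := fun n => by
    filter_upwards [enorm_le_of_le_abs (hx n).1 (hx n).2, enorm_smul_ae ε⁻¹ (x n),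
      enorm_smul_ae ε⁻¹ f] with a h1 h2 h3
    rw [h2, h3]
    gcongr
  have hlim : ∀ᵐ a ∂μ, Tendsto (fun n => (ε⁻¹ • x n) a) atTop (𝓝 0) := by
    filter_upwards [h0, ae_all_iff.2 fun n => AEEqFun.coeFn_smul ε⁻¹ (x n)] with a h1 h2
    simpa [h2] using h1.const_mul ε⁻¹
  filter_upwards [(hν.tendsto_modular_zero (hf ε hε) hle hlim).eventually_le_const zero_lt_one]
    with n hn
  exact (luxemburgNorm_le hε hn).trans hεe

variable [SigmaFinite μ]

/-- The two norms are equivalent on the space, and elements dominated by `|f|` stay in it. -/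
theorem isOrderContinuous_orliczNorm_iff (hν : IsWeightMeasure μ J ν) {f : α →ₘ[μ] ℝ}
    (hf : f ∈ spaceCarrier μ J φ) :
    IsOrderContinuous (orliczNorm J φ) f ↔ IsOrderContinuous (luxemburgNorm J φ) f := by
  refine forall_congr' fun x => forall_congr' fun hx => forall_congr' fun _ =>
    forall_congr' fun _ => ⟨fun h => ?_, fun h => ?_⟩
  · exact tendsto_of_tendsto_of_tendsto_of_le_of_le tendsto_const_nhds h (fun _ => bot_le)
      fun n => hν.luxemburgNorm_le_orliczNorm
        (hν.mem_spaceCarrier_of_enorm_le hf (enorm_le_of_le_abs (hx n).1 (hx n).2))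
  · have h2 : Tendsto (fun n => 2 * luxemburgNorm J φ (x n)) atTop (𝓝 0) := by
      simpa using ENNReal.Tendsto.const_mul h (Or.inr ENNReal.ofNat_ne_top)
    exact tendsto_of_tendsto_of_tendsto_of_le_of_le tendsto_const_nhds h2 (fun _ => bot_le)
      fun n => hν.orliczNorm_le_two_mul φ _

theorem isBoundedFunctional_orliczNorm_iff (hν : IsWeightMeasure μ J ν) (hJ : IsAdmissible J)
    (S : space μ hJ φ →ₗ[ℝ] ℝ) : IsBoundedFunctional (orliczNorm J φ) S ↔
      IsBoundedFunctional (luxemburgNorm J φ) S := by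
  refine ⟨fun ⟨C, hC⟩ => ⟨C * 2, fun f => (hC f).trans ?_⟩,
    fun ⟨C, hC⟩ => ⟨C, fun f => (hC f).trans ?_⟩⟩
  · rw [ENNReal.coe_mul, mul_assoc]
    exact mul_le_mul' le_rfl (hν.orliczNorm_le_two_mul φ _)
  · exact mul_le_mul' le_rfl (hν.luxemburgNorm_le_orliczNorm f.2)

theorem isSingular_orliczNorm_iff (hν : IsWeightMeasure μ J ν) (hJ : IsAdmissible J)
    (S : space μ hJ φ →ₗ[ℝ] ℝ) : IsSingular (orliczNorm J φ) S ↔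
      IsSingular (luxemburgNorm J φ) S :=
  and_congr (hν.isBoundedFunctional_orliczNorm_iff hJ S) (forall_congr' fun f => by
    rw [hν.isOrderContinuous_orliczNorm_iff f.2])

end IsWeightMeasure

/-! ### Dual norms, `θ`, and the norm formulas -/

theorem bddAbove_of_isBoundedFunctional {N : (α →ₘ[μ] ℝ) → ℝ≥0∞} {X : Submodule ℝ (α →ₘ[μ] ℝ)}
    {S : X →ₗ[ℝ] ℝ} (hS : IsBoundedFunctional N S) :
    BddAbove {r | ∃ f : X, N f ≤ 1 ∧ r = |S f|} := by
  obtain ⟨C, hC⟩ := hS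
  refine ⟨C, ?_⟩
  rintro _ ⟨f, hf, rfl⟩
  have h : ‖S f‖ₑ ≤ C := (hC f).trans (mul_le_of_le_one_right' hf)
  rw [Real.enorm_eq_ofReal_abs] at h
  simpa using ENNReal.toReal_mono ENNReal.coe_ne_top h

theorem abs_le_dualNorm {N : (α →ₘ[μ] ℝ) → ℝ≥0∞} {X : Submodule ℝ (α →ₘ[μ] ℝ)}
    {S : X →ₗ[ℝ] ℝ} (hS : IsBoundedFunctional N S) {f : X} (hf : N f ≤ 1) :
    |S f| ≤ dualNorm N S :=
  le_csSup (bddAbove_of_isBoundedFunctional hS) ⟨f, hf, rfl⟩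

theorem dualNorm_nonneg (N : (α →ₘ[μ] ℝ) → ℝ≥0∞) {X : Submodule ℝ (α →ₘ[μ] ℝ)}
    (S : X →ₗ[ℝ] ℝ) : 0 ≤ dualNorm N S :=
  Real.sSup_nonneg (by rintro _ ⟨f, -, rfl⟩; exact abs_nonneg _)

theorem theta_nonneg (J : (ℝ≥0∞ → ℝ≥0∞) → ℝ≥0∞) (φ : OrliczFunction) (f : α →ₘ[μ] ℝ) :
    0 ≤ theta J φ f :=
  Real.sInf_nonneg fun _ h => h.1.le

theorem theta_le_one {f : α →ₘ[μ] ℝ} (hf : modular J φ.ext f < ⊤) : theta J φ f ≤ 1 :=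
  csInf_le ⟨0, fun _ h => h.1.le⟩ ⟨one_pos, by simpa using hf⟩

theorem modular_zero_lt_top {hJ : IsAdmissible J} :
    modular J φ.ext ((0 : space μ hJ φ) : α →ₘ[μ] ℝ) < ⊤ := by
  obtain ⟨c, _, h⟩ := (space μ hJ φ).zero_mem
  simpa using h

namespace IsWeightMeasure

theorem modular_lt_top_of_theta_lt (hν : IsWeightMeasure μ J ν) {f : α →ₘ[μ] ℝ}
    (hf : f ∈ spaceCarrier μ J φ) {c : ℝ} (hc : theta J φ f < c) :
    modular J φ.ext (c⁻¹ • f) < ⊤ := by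
  obtain ⟨b, hb, hfb⟩ := hf
  obtain ⟨d, hd, hdc⟩ := exists_lt_of_csInf_lt
    (s := {c : ℝ | 0 < c ∧ modular J φ.ext (c⁻¹ • f) < ⊤})
    ⟨b⁻¹, inv_pos.2 hb, by simpa using hfb⟩ hc
  refine (hν.modular_smul_mono φ (inv_nonneg.2 (hd.1.trans hdc).le) ?_ f).trans_lt hd.2
  exact inv_anti₀ hd.1 hdc.le

/-- If `θ(f) = 0`, every multiple of `f` has finite modular, so `f` is order-continuous. Thus the
quotients `S f / θ(f)` never divide by zero. -/
theorem theta_pos (hν : IsWeightMeasure μ J ν) {f : α →ₘ[μ] ℝ} (hf : f ∈ spaceCarrier μ J φ)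
    (h : ¬ IsOrderContinuous (luxemburgNorm J φ) f) : 0 < theta J φ f := by
  refine (theta_nonneg J φ f).lt_of_ne fun h0 => h ?_
  exact hν.isOrderContinuous_of_modular_lt_top fun ε hε =>
    hν.modular_lt_top_of_theta_lt hf (h0 ▸ hε)

theorem dualNorm_luxemburgNorm_le (hν : IsWeightMeasure μ J ν) (hJ : IsAdmissible J)
    (S : space μ hJ φ →ₗ[ℝ] ℝ) {b : ℝ}
    (hb : ∀ f : space μ hJ φ, modular J φ.ext (f : α →ₘ[μ] ℝ) < ⊤ → S f ≤ b) :
    dualNorm (luxemburgNorm J φ) S ≤ b := by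
  have hb0 : 0 ≤ b := by simpa using hb 0 modular_zero_lt_top
  refine Real.sSup_le ?_ hb0
  rintro _ ⟨f, hf, rfl⟩
  refine le_of_forall_gt_imp_ge_of_dense fun c hc => ?_
  have hcpos : 0 < c := hb0.trans_lt hc
  by_contra! hlt
  have hfpos : 0 < |S f| := hcpos.trans hlt
  -- If `|S f| > b`, some `ε` admissible for the Luxemburg norm satisfies `ε b < |S f|`: take `ε <
  -- |S f| / b`. When `b = 0` any admissible `ε` works, so one below `2` is taken.
  have h1 : (1 : ℝ≥0∞) < ENNReal.ofReal (|S f| / b) ∨ b = 0 := by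
    rcases hb0.eq_or_lt with h | h
    · exact Or.inr h.symm
    · exact Or.inl (ENNReal.one_lt_ofReal.2 ((one_lt_div h).2 (hc.trans hlt)))
  obtain ⟨ε, hε, hεb, hm⟩ : ∃ ε : ℝ, 0 < ε ∧ ε * b < |S f| ∧
      modular J φ.ext (ε⁻¹ • (f : α →ₘ[μ] ℝ)) ≤ 1 := by
    rcases h1 with h1 | h1
    · obtain ⟨ε, h2, h3, h4⟩ := exists_modular_le_one_of_luxemburgNorm_lt (hf.trans_lt h1)
      refine ⟨ε, h2, ?_, h4⟩
      have hb' : 0 < b := by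
        refine hb0.lt_of_ne fun h => ?_
        simp [← h] at h1
      rw [ENNReal.ofReal_lt_ofReal_iff (by positivity)] at h3
      exact (lt_div_iff₀ hb').1 h3
    · obtain ⟨ε, h2, h3, h4⟩ := exists_modular_le_one_of_luxemburgNorm_lt
        (hf.trans_lt ENNReal.one_lt_two)
      exact ⟨ε, h2, by simpa [h1] using hfpos, h4⟩
  have h2 : ∀ g : space μ hJ φ, modular J φ.ext (ε⁻¹ • (g : α →ₘ[μ] ℝ)) < ⊤ → S g ≤ ε * b :=
    fun g hg => by
      have := hb (ε⁻¹ • g) hg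
      rwa [map_smul, smul_eq_mul, inv_mul_le_iff₀ hε] at this
  have h3 := h2 f (hm.trans_lt ENNReal.one_lt_top)
  -- `-f` has the same modular, so the one-sided bound on `S` yields a bound on `|S f|`.
  have h4 := h2 (-f) (lt_of_le_of_lt (hν.modular_mono φ (g := ε⁻¹ • (f : α →ₘ[μ] ℝ)) (by
    filter_upwards [enorm_smul_ae ε⁻¹ (f : α →ₘ[μ] ℝ), enorm_smul_ae ε⁻¹ (-f : α →ₘ[μ] ℝ),
      AEEqFun.coeFn_neg (f : α →ₘ[μ] ℝ)] with a h5 h6 h7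
    rw [h5]
    refine h6.le.trans ?_
    rw [h7, Pi.neg_apply, enorm_neg])) (hm.trans_lt ENNReal.one_lt_top))
  rw [map_neg] at h4
  exact (abs_le.2 ⟨by linarith, h3⟩).not_gt hεb

variable [SigmaFinite μ]

/-- A singular functional is bounded on the functions of finite modular by its norm as a
functional for the Orlicz norm: such functions differ from order-continuous ones by functions of
small modular, whose Orlicz norm is at most `1 + ε`. -/
theorem le_dualNorm_orliczNorm (hν : IsWeightMeasure μ J ν) (hJ : IsAdmissible J)
    {S : space μ hJ φ →ₗ[ℝ] ℝ} (hS : IsSingular (orliczNorm J φ) S) {f : space μ hJ φ}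
    (hf : modular J φ.ext (f : α →ₘ[μ] ℝ) < ⊤) : S f ≤ dualNorm (orliczNorm J φ) S := by
  have hlim := hν.tendsto_modular_zero hf (fun n => enorm_sub_trunc_le (f : α →ₘ[μ] ℝ) n)
    (tendsto_sub_trunc (f : α →ₘ[μ] ℝ))
  have key : ∀ ε : ℝ, 0 < ε → S f ≤ (1 + ε) * dualNorm (orliczNorm J φ) S := fun ε hε => by
    obtain ⟨n, hn⟩ := (hlim.eventually_le_const (ENNReal.ofReal_pos.2 hε)).exists
    have hmem : trunc (f : α →ₘ[μ] ℝ) n ∈ space μ hJ φ :=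
      ⟨1, one_pos, hν.modular_smul_trunc_lt_top φ 1 _ n⟩
    set g : space μ hJ φ := ⟨trunc (f : α →ₘ[μ] ℝ) n, hmem⟩ with hg
    -- Every multiple of a truncation has finite modular, so the truncation is order-continuous and
    -- `S` annihilates it.
    have hSg : S g = 0 := hS.2 g <| (hν.isOrderContinuous_orliczNorm_iff g.2).2 <|
      hν.isOrderContinuous_of_modular_lt_top fun ε _ =>
        hν.modular_smul_trunc_lt_top φ ε⁻¹ _ n
    have hpos : 0 < 1 + ε := by linarith
    have hN : orliczNorm J φ (((1 + ε)⁻¹ • (f - g) : space μ hJ φ) : α →ₘ[μ] ℝ) ≤ 1 := by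
      change orliczNorm J φ ((1 + ε)⁻¹ • ((f : α →ₘ[μ] ℝ) - trunc (f : α →ₘ[μ] ℝ) n)) ≤ 1
      rw [hν.orliczNorm_smul φ (inv_ne_zero hpos.ne'), enorm_inv hpos.ne',
        ENNReal.inv_mul_le_iff (by simpa using hpos.ne') (by simp), mul_one,
        Real.enorm_of_nonneg hpos.le, ENNReal.ofReal_add zero_le_one hε.le, ENNReal.ofReal_one]
      exact (hν.orliczNorm_le_one_add φ _).trans (by gcongr)
    have h := (le_abs_self _).trans (abs_le_dualNorm hS.1 hN)
    rw [map_smul, map_sub, hSg, sub_zero, smul_eq_mul, inv_mul_le_iff₀ hpos] at h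
    exact h
  have hl : Tendsto (fun ε : ℝ => (1 + ε) * dualNorm (orliczNorm J φ) S) (𝓝[>] 0)
      (𝓝 ((1 + 0) * dualNorm (orliczNorm J φ) S)) := by
    have : Continuous fun ε : ℝ => (1 + ε) * dualNorm (orliczNorm J φ) S := by fun_prop
    exact (this.tendsto 0).mono_left nhdsWithin_le_nhds
  simpa using ge_of_tendsto hl (by filter_upwards [self_mem_nhdsWithin] with ε hε using key ε hε)

/-- The norm formulas for singular functionals. -/
theorem dualNorm_of_isSingular (hν : IsWeightMeasure μ J ν) (hJ : IsAdmissible J)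
    (S : space μ hJ φ →ₗ[ℝ] ℝ)
    (hS : IsSingular (luxemburgNorm J φ) S ∨ IsSingular (orliczNorm J φ) S) :
    IsBoundedFunctional (luxemburgNorm J φ) S ∧ IsBoundedFunctional (orliczNorm J φ) S ∧
    dualNorm (luxemburgNorm J φ) S = dualNorm (orliczNorm J φ) S ∧
    IsLUB {r : ℝ | ∃ f : space μ hJ φ, modular J φ.ext (f : α →ₘ[μ] ℝ) < ⊤ ∧ r = S f}
      (dualNorm (luxemburgNorm J φ) S) ∧
    ((∃ f : space μ hJ φ, ¬ IsOrderContinuous (luxemburgNorm J φ) (f : α →ₘ[μ] ℝ)) →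
      IsLUB {r : ℝ | ∃ f : space μ hJ φ,
          ¬ IsOrderContinuous (luxemburgNorm J φ) (f : α →ₘ[μ] ℝ) ∧
          r = S f / theta J φ (f : α →ₘ[μ] ℝ)}
        (dualNorm (luxemburgNorm J φ) S)) ∧
    ((∀ f : space μ hJ φ, IsOrderContinuous (luxemburgNorm J φ) (f : α →ₘ[μ] ℝ)) →
      dualNorm (luxemburgNorm J φ) S = 0) := by
  have hSL : IsSingular (luxemburgNorm J φ) S :=
    hS.elim id fun h => (hν.isSingular_orliczNorm_iff hJ S).1 h
  have hSO : IsSingular (orliczNorm J φ) S := (hν.isSingular_orliczNorm_iff hJ S).2 hSL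
  have hOL : dualNorm (orliczNorm J φ) S ≤ dualNorm (luxemburgNorm J φ) S := by
    refine Real.sSup_le ?_ (dualNorm_nonneg _ _)
    rintro _ ⟨f, hf, rfl⟩
    exact abs_le_dualNorm hSL.1 ((hν.luxemburgNorm_le_orliczNorm f.2).trans hf)
  have hle : ∀ f : space μ hJ φ, modular J φ.ext (f : α →ₘ[μ] ℝ) < ⊤ →
      S f ≤ dualNorm (luxemburgNorm J φ) S := fun f hf =>
    (hν.le_dualNorm_orliczNorm hJ hSO hf).trans hOL
  refine ⟨hSL.1, hSO.1, le_antisymm ?_ hOL, ⟨?_, ?_⟩, fun hex => ⟨?_, ?_⟩, fun hall => ?_⟩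
  · exact hν.dualNorm_luxemburgNorm_le hJ S fun f hf => hν.le_dualNorm_orliczNorm hJ hSO hf
  · rintro _ ⟨f, hf, rfl⟩
    exact hle f hf
  · exact fun b hb => hν.dualNorm_luxemburgNorm_le hJ S fun f hf => hb ⟨f, hf, rfl⟩
  · rintro _ ⟨f, hf, rfl⟩
    have hpos := hν.theta_pos f.2 hf
    rw [div_le_iff₀ hpos, mul_comm]
    -- The infimum `θ(f)` need not be attained, so the bound is taken for `c > θ(f)` and `c`
    -- decreases to it.
    have hl : Tendsto (fun c : ℝ => c * dualNorm (luxemburgNorm J φ) S)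
        (𝓝[>] (theta J φ (f : α →ₘ[μ] ℝ)))
        (𝓝 (theta J φ (f : α →ₘ[μ] ℝ) * dualNorm (luxemburgNorm J φ) S)) :=
      ((continuous_mul_const _).tendsto _).mono_left nhdsWithin_le_nhds
    refine ge_of_tendsto hl ?_
    filter_upwards [self_mem_nhdsWithin] with c (hc : _ < c)
    have := hle (c⁻¹ • f) (hν.modular_lt_top_of_theta_lt f.2 hc)
    rwa [map_smul, smul_eq_mul, inv_mul_le_iff₀ (hpos.trans hc)] at this
  · intro b hb
    have hmul : ∀ f : space μ hJ φ, ¬ IsOrderContinuous (luxemburgNorm J φ) (f : α →ₘ[μ] ℝ) →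
        S f ≤ b * theta J φ (f : α →ₘ[μ] ℝ) := fun f hf =>
      (div_le_iff₀ (hν.theta_pos f.2 hf)).1 (hb ⟨f, hf, rfl⟩)
    -- The elements that are not order-continuous are closed under negation and `S (-f) = -S f`, so
    -- a negative upper bound is impossible.
    have hb0 : 0 ≤ b := by
      obtain ⟨f, hf⟩ := hex
      have hneg : ¬ IsOrderContinuous (luxemburgNorm J φ) ((-f : space μ hJ φ) : α →ₘ[μ] ℝ) := by
        simpa [IsOrderContinuous] using hf
      by_contra! hlt
      have h1 := hmul f hf
      have h2 := hmul (-f) hneg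
      rw [map_neg] at h2
      have h3 := mul_neg_of_neg_of_pos hlt (hν.theta_pos f.2 hf)
      have h4 := mul_neg_of_neg_of_pos hlt (hν.theta_pos (-f).2 hneg)
      linarith
    refine hν.dualNorm_luxemburgNorm_le hJ S fun f hf => ?_
    by_cases hoc : IsOrderContinuous (luxemburgNorm J φ) (f : α →ₘ[μ] ℝ)
    · rw [hSL.2 f hoc]
      exact hb0
    · exact (hmul f hoc).trans (mul_le_of_le_one_right hb0 (theta_le_one hf))
  · refine le_antisymm (Real.sSup_le ?_ le_rfl) (dualNorm_nonneg _ _)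
    rintro _ ⟨f, -, rfl⟩
    simp [hSL.2 f (hall f)]

end IsWeightMeasure

end Dual

/-! ### The weight measures of function and sequence spaces -/

theorem measurableSet_interval (γ : ℝ≥0∞) : MeasurableSet (interval γ) :=
  (measurableSet_Ici (a := (0 : ℝ))).inter
    (measurableSet_lt ENNReal.measurable_ofReal measurable_const)

instance (γ : ℝ≥0∞) : SigmaFinite (intervalMeasure γ) := by
  unfold intervalMeasure
  infer_instance

theorem ae_intervalMeasure_pos (γ : ℝ≥0∞) : ∀ᵐ t ∂(intervalMeasure γ), 0 < t := by
  have h : ∀ᵐ t ∂(intervalMeasure γ), t ≠ 0 := by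
    refine ae_restrict_of_ae ?_
    simp [ae_iff]
  filter_upwards [h, ae_restrict_mem (measurableSet_interval γ)] with t h1 h2
  exact h2.1.lt_of_ne' h1

theorem FunctionWeight.aemeasurable {γ : ℝ≥0∞} (w : FunctionWeight γ) :
    AEMeasurable w.toFun (intervalMeasure γ) := by
  have h1 : AEMeasurable w.toFun (volume.restrict (interval γ ∩ Ioi 0)) :=
    aemeasurable_restrict_of_antitoneOn ((measurableSet_interval γ).inter measurableSet_Ioi)
      w.antitone
  have h2 := Measure.restrict_eq_self_of_ae_mem (s := Ioi 0) (ae_intervalMeasure_pos γ)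
  rw [intervalMeasure, Measure.restrict_restrict measurableSet_Ioi, inter_comm] at h2
  rwa [h2] at h1

/-- Split at a point `s` of `(0, γ)`: below it the weight is integrable, possibly unbounded; above
it the weight is at most `w(s)` on a set of finite length. -/
theorem FunctionWeight.setLIntegral_lt_top {γ : ℝ≥0∞} (hγ : 0 < γ) (w : FunctionWeight γ)
    {T : ℝ≥0∞} (hT : T < ⊤) :
    ∫⁻ t in {t | ENNReal.ofReal t < T}, ENNReal.ofReal (w.toFun t) ∂(intervalMeasure γ) < ⊤ := by
  obtain ⟨s, hs0, hsγ⟩ : ∃ s : ℝ, 0 < s ∧ ENNReal.ofReal s < γ := by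
    obtain ⟨r, h1, h2⟩ := ENNReal.lt_iff_exists_nnreal_btwn.1 hγ
    exact ⟨r, by exact_mod_cast h1, by simpa using h2⟩
  have hsI : s ∈ interval γ := ⟨hs0.le, hsγ⟩
  have hmeas : MeasurableSet {t : ℝ | ENNReal.ofReal t < T} :=
    measurableSet_lt ENNReal.measurable_ofReal measurable_const
  rw [intervalMeasure, Measure.restrict_restrict hmeas]
  set B := (interval γ ∩ Ici s) ∩ {t : ℝ | ENNReal.ofReal t < T} with hB
  have hBm : MeasurableSet B := ((measurableSet_interval γ).inter measurableSet_Ici).inter hmeas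
  have hsub : {t : ℝ | ENNReal.ofReal t < T} ∩ interval γ ⊆ ({0} ∪ Ioo 0 s) ∪ B := by
    rintro t ⟨h1, h2⟩
    rcases lt_or_ge t s with h | h
    · rcases h2.1.eq_or_lt with h0 | h0
      · exact Or.inl (Or.inl h0.symm)
      · exact Or.inl (Or.inr ⟨h0, h⟩)
    · exact Or.inr ⟨⟨h2, h⟩, h1⟩
  have h1 : ∫⁻ t in Ioo 0 s, ENNReal.ofReal (w.toFun t) < ⊤ :=
    ((w.integrable s hsI).lintegral_lt_top)
  have h2 : ∫⁻ t in B, ENNReal.ofReal (w.toFun t) < ⊤ := by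
    refine (setLIntegral_mono_ae' (g := fun _ => ENNReal.ofReal (w.toFun s)) hBm
      (Eventually.of_forall fun t ht => ENNReal.ofReal_le_ofReal
        (w.antitone ⟨hsI, hs0⟩ ⟨ht.1.1, hs0.trans_le ht.1.2⟩ ht.1.2))).trans_lt ?_
    rw [setLIntegral_const]
    refine ENNReal.mul_lt_top ENNReal.ofReal_lt_top ?_
    refine (measure_mono (t := Icc s T.toReal) fun t ht => ⟨ht.1.2, ?_⟩).trans_lt
      measure_Icc_lt_top
    exact (ENNReal.ofReal_le_iff_le_toReal hT.ne).1 (le_of_lt ht.2)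
  refine (lintegral_mono_set hsub).trans_lt ((lintegral_union_le _ _ _).trans_lt ?_)
  refine ENNReal.add_lt_top.2 ⟨(lintegral_union_le _ _ _).trans_lt ?_, h2⟩
  exact ENNReal.add_lt_top.2 ⟨by simp, h1⟩

/-- The image of `w(t) dt` in `[0, ∞]`. -/
noncomputable def FunctionWeight.measure {γ : ℝ≥0∞} (w : FunctionWeight γ) : Measure ℝ≥0∞ :=
  ((intervalMeasure γ).withDensity fun t => ENNReal.ofReal (w.toFun t)).map ENNReal.ofReal

theorem FunctionWeight.measure_Iio {γ : ℝ≥0∞} (w : FunctionWeight γ) (T : ℝ≥0∞) :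
    w.measure (Iio T) =
      ∫⁻ t in {t | ENNReal.ofReal t < T}, ENNReal.ofReal (w.toFun t) ∂(intervalMeasure γ) := by
  rw [FunctionWeight.measure, Measure.map_apply ENNReal.measurable_ofReal measurableSet_Iio,
    withDensity_apply _ (ENNReal.measurable_ofReal measurableSet_Iio)]
  rfl

theorem FunctionWeight.isWeightMeasure {γ : ℝ≥0∞} (hγ : 0 < γ) (w : FunctionWeight γ) :
    IsWeightMeasure (intervalMeasure γ) (functionIntegral w) w.measure where
  eq_lintegral h hh := by
    rw [FunctionWeight.measure, lintegral_map hh.measurable ENNReal.measurable_ofReal,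
      lintegral_withDensity_eq_lintegral_mul₀ w.aemeasurable.ennreal_ofReal
        (g := fun t => h (ENNReal.ofReal t))
        (hh.measurable.comp ENNReal.measurable_ofReal).aemeasurable]
    simp only [functionIntegral, Pi.mul_apply, mul_comm]
  finite T hT := by
    rw [w.measure_Iio]
    exact w.setLIntegral_lt_top hγ hT
  infinite h := by
    have hγt : γ = ⊤ := by
      by_contra hne
      rw [intervalMeasure, Measure.restrict_apply_univ] at h
      refine (measure_mono (t := Icc 0 γ.toReal) fun t ht => ⟨ht.1, ?_⟩).trans_lt
        (measure_Icc_lt_top (μ := volume)) |>.ne h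
      exact (ENNReal.ofReal_le_iff_le_toReal hne).1 ht.2.le
    have hu : {t : ℝ | ENNReal.ofReal t < ⊤} = univ :=
      eq_univ_of_forall fun t => ENNReal.ofReal_lt_top
    rw [w.measure_Iio, hu, Measure.restrict_univ, ← top_le_iff, ← w.infinite hγt]
    refine lintegral_mono_set fun t (ht : 0 < t) => ⟨ht.le, ?_⟩
    rw [hγt]
    exact ENNReal.ofReal_lt_top
  eventually_le := by
    -- This measure does not charge `0`, and for `t > 0` any sequence tending to `0` is eventually
    -- at most `t`.
    have h : ∀ᵐ t ∂w.measure, 0 < t := by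
      rw [FunctionWeight.measure, ae_map_iff ENNReal.measurable_ofReal.aemeasurable
        measurableSet_Ioi]
      filter_upwards [(withDensity_absolutelyContinuous _ _).ae_le (ae_intervalMeasure_pos γ)]
        with t ht
      exact ENNReal.ofReal_pos.2 ht
    filter_upwards [h] with t ht A hA
    exact hA.eventually_le_const ht

/-- The measure `∑ w(i) δ_i`. -/
noncomputable def SequenceWeight.measure (w : SequenceWeight) : Measure ℝ≥0∞ :=
  Measure.sum fun i : ℕ => ENNReal.ofReal (w.toFun i) • Measure.dirac (i : ℝ≥0∞)

theorem SequenceWeight.lintegral_measure (w : SequenceWeight) {h : ℝ≥0∞ → ℝ≥0∞}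
    (hh : Measurable h) :
    ∫⁻ t, h t ∂w.measure = ∑' i : ℕ, h i * ENNReal.ofReal (w.toFun i) := by
  rw [SequenceWeight.measure, lintegral_sum_measure]
  refine tsum_congr fun i => ?_
  rw [lintegral_smul_measure, lintegral_dirac' _ hh, smul_eq_mul, mul_comm]

theorem SequenceWeight.measure_Iio (w : SequenceWeight) (T : ℝ≥0∞) :
    w.measure (Iio T) =
      ∑' i : ℕ, (Iio T).indicator 1 (i : ℝ≥0∞) * ENNReal.ofReal (w.toFun i) := by
  rw [← w.lintegral_measure (measurable_one.indicator measurableSet_Iio),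
    lintegral_indicator_one measurableSet_Iio]

theorem SequenceWeight.isWeightMeasure (w : SequenceWeight) :
    IsWeightMeasure (Measure.count : Measure ℕ) (sequenceSum w) w.measure where
  eq_lintegral h hh := (w.lintegral_measure hh.measurable).symm
  finite T hT := by
    obtain ⟨n, hn⟩ := ENNReal.exists_nat_gt hT.ne
    rw [w.measure_Iio, tsum_eq_sum (s := Finset.range n)]
    · refine ENNReal.sum_lt_top.2 fun i _ => ENNReal.mul_lt_top ?_ ENNReal.ofReal_lt_top
      exact (indicator_le_self' (fun _ _ => zero_le_one) _).trans_lt ENNReal.one_lt_top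
    · intro i hi
      have hni : (n : ℝ≥0∞) ≤ i := by exact_mod_cast not_lt.1 (Finset.mem_range.not.1 hi)
      rw [indicator_of_notMem (show (i : ℝ≥0∞) ∉ Iio T from (hn.trans_le hni).not_gt), zero_mul]
  infinite _ := by
    rw [w.measure_Iio]
    by_contra hne
    refine w.not_summable ?_
    simpa [ENNReal.toReal_ofReal (w.pos _).le] using ENNReal.summable_toReal hne
  eventually_le := Eventually.of_forall fun t A hA => by
    -- A set of counting measure less than `1` is empty, so the bound holds for every `t`, including
    -- the atom at `0`.
    filter_upwards [hA.eventually_lt_const zero_lt_one] with n hn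
    have : A n = ∅ := by
      refine eq_empty_iff_forall_notMem.2 fun a ha => hn.not_ge ?_
      rw [← Measure.count_singleton a]
      exact measure_mono (singleton_subset_iff.2 ha)
    simp [this]

end OrliczLorentz

theorem mainTheorem5 (φ : OrliczFunction) :
    (∀ (γ : ℝ≥0∞) (_ : 0 < γ) (w : FunctionWeight γ) (S : functionSpace φ w →ₗ[ℝ] ℝ),
      (IsSingular (luxemburgNorm (functionIntegral w) φ) S ∨
        IsSingular (orliczNorm (functionIntegral w) φ) S) →
      IsBoundedFunctional (luxemburgNorm (functionIntegral w) φ) S ∧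
      IsBoundedFunctional (orliczNorm (functionIntegral w) φ) S ∧
      dualNorm (luxemburgNorm (functionIntegral w) φ) S =
        dualNorm (orliczNorm (functionIntegral w) φ) S ∧
      IsLUB {r : ℝ | ∃ f : functionSpace φ w,
          modular (functionIntegral w) φ.ext (f : ℝ →ₘ[intervalMeasure γ] ℝ) < ⊤ ∧ r = S f}
        (dualNorm (luxemburgNorm (functionIntegral w) φ) S) ∧
      ((∃ f : functionSpace φ w, ¬ IsOrderContinuous (luxemburgNorm (functionIntegral w) φ)
          (f : ℝ →ₘ[intervalMeasure γ] ℝ)) →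
        IsLUB {r : ℝ | ∃ f : functionSpace φ w,
            ¬ IsOrderContinuous (luxemburgNorm (functionIntegral w) φ)
              (f : ℝ →ₘ[intervalMeasure γ] ℝ) ∧
            r = S f / theta (functionIntegral w) φ (f : ℝ →ₘ[intervalMeasure γ] ℝ)}
          (dualNorm (luxemburgNorm (functionIntegral w) φ) S)) ∧
      ((∀ f : functionSpace φ w, IsOrderContinuous (luxemburgNorm (functionIntegral w) φ)
          (f : ℝ →ₘ[intervalMeasure γ] ℝ)) →
        dualNorm (luxemburgNorm (functionIntegral w) φ) S = 0)) ∧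
    (∀ (w : SequenceWeight) (S : sequenceSpace φ w →ₗ[ℝ] ℝ),
      (IsSingular (luxemburgNorm (sequenceSum w) φ) S ∨
        IsSingular (orliczNorm (sequenceSum w) φ) S) →
      IsBoundedFunctional (luxemburgNorm (sequenceSum w) φ) S ∧
      IsBoundedFunctional (orliczNorm (sequenceSum w) φ) S ∧
      dualNorm (luxemburgNorm (sequenceSum w) φ) S = dualNorm (orliczNorm (sequenceSum w) φ) S ∧
      IsLUB {r : ℝ | ∃ x : sequenceSpace φ w,
          modular (sequenceSum w) φ.ext (x : ℕ →ₘ[Measure.count] ℝ) < ⊤ ∧ r = S x}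
        (dualNorm (luxemburgNorm (sequenceSum w) φ) S) ∧
      ((∃ x : sequenceSpace φ w, ¬ IsOrderContinuous (luxemburgNorm (sequenceSum w) φ)
          (x : ℕ →ₘ[Measure.count] ℝ)) →
        IsLUB {r : ℝ | ∃ x : sequenceSpace φ w,
            ¬ IsOrderContinuous (luxemburgNorm (sequenceSum w) φ)
              (x : ℕ →ₘ[Measure.count] ℝ) ∧
            r = S x / theta (sequenceSum w) φ (x : ℕ →ₘ[Measure.count] ℝ)}
          (dualNorm (luxemburgNorm (sequenceSum w) φ) S)) ∧
      ((∀ x : sequenceSpace φ w, IsOrderContinuous (luxemburgNorm (sequenceSum w) φ)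
          (x : ℕ →ₘ[Measure.count] ℝ)) →
        dualNorm (luxemburgNorm (sequenceSum w) φ) S = 0)) := by
  exact ⟨fun _ hγ w S hS => (w.isWeightMeasure hγ).dualNorm_of_isSingular _ S hS,
    fun w S hS => w.isWeightMeasure.dualNorm_of_isSingular _ S hS⟩
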